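/- **Definitions.** A *Ferrers board* is a set $F$ of unit squares of the $n\times n$ array with bottom left corner $(0,0)$ that contains, with each of its squares, every square weakly to the left of and weakly below it; its *border* is the lattice path from $V_0=(0,n)$ to $V_{2n}=(n,0)$ with east and south steps that, together with the coordinate axes, bounds $F$, with vertices $V_0,\dots,V_{2n}$. Let $\mathcal F_n$ be the set of Ferrers boards with $n$ non-empty rows and $n$ non-empty columns whose border $D_F$ stays weakly above the line $y=n-x$. A *Dyck path* of semilength $n$ is a lattice path from $(0,n)$ to $(n,0)$ with east and south steps that stays weakly above $y=n-x$; its *height sequence* is $d_0,\dots,d_{2n}$, where $d_i=x+y-n$ if its $i$-th vertex is $(x,y)$. For $F\in\mathcal F_n$ let $\mathcal D_F^2$ be the set of pairs $(D_0,D_F)$ of Dyck paths of semilength $n$ such that $D_0$ never goes above $D_F$. A *full rook placement* on $F$ is a set $R$ of squares of $F$ such that each non-empty row and each non-empty column of $F$ contains exactly one element of $R$. For a vertex $V=(a,b)$ let $\Gamma(V)$ be the set of unit squares in $[0,a]\times[0,b]$; the squares of $R\cap\Gamma(V)$ determine a permutation (columns numbered from left to right, rows from bottom to top, empty rows and columns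 deleted). $R$ *avoids* a pattern $\tau$ if for every vertex $V$ of the border of $F$ the permutation given by $R\cap\Gamma(V)$ avoids $\tau$. Let $\mathcal R_F(\tau)$ be the set of full rook placements on $F$ that avoid $\tau$. Two patterns $\sigma,\tau$ are *shape-Wilf-equivalent*, $\sigma\sim\tau$, if $|\mathcal R_F(\sigma)|=|\mathcal R_F(\tau)|$ for every Ferrers board $F$. Given a perfect matching $M$ of $\{1,\dots,2n\}$ with pairs $(i,j)$, $i<j$ ($i$ an opener, $j$ a closer), start at $(0,n)$ and read the points in increasing order, making an east step for each opener and a south step for each closer. This path is the border of a board $F\in\mathcal F_n$, the *shape* of $M$. Let $\kappa(M)$ be the full rook placement on $F$ with, for each pair $(i,j)$ of $M$, a rook in the column below the step of $i$ and the row to the left of the step of $j$. Let $\mathcal M_F(\tau)$ be the set of perfect matchings $M$ of shape $F$ with $\kappa(M)\in\mathcal R_F(\tau)$. **Theorem.** Let $n\ge 0$ and $F\in\mathcal F_n$, with border vertices $V_0,\dots,V_{2n}$, and let $h_0,\dots,h_{2n}$ be the height sequence of $D_F$. 1. There is a map $\delta_{321}:\mathcal R_F(321)\to\mathcal D_F^2$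 with $\delta_{321}(R)=(D_R,D_F)$, where $D_R$ is the Dyck path with height sequence $2\ell_i-h_i$ $(0\le i\le 2n)$ and $\ell_i$ is the length of the longest increasing sequence in $R\cap\Gamma(V_i)$. The map $\delta_{321}$ is a bijection, and so is $\Delta_{321}=\delta_{321}\circ\kappa:\mathcal M_F(321)\to\mathcal D_F^2$. 2. There is a map $\delta_{213}:\mathcal R_F(213)\to\mathcal D_F^2$ with $\delta_{213}(R)=(D_{F_R},D_F)$, where $F_R$ is the minimal Ferrers board containing $R$ and $D_{F_R}$ is its border. The map $\delta_{213}$ is a bijection, and so is $\Delta_{213}=\delta_{213}\circ\kappa:\mathcal M_F(213)\to\mathcal D_F^2$. Consequently, $321\sim 213$. -/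

import Mathlib

namespace FerrersMatching

/-! ### Ferrers boards

A Ferrers board is a finite lower set of unit squares of the quadrant, i.e. a `YoungDiagram`.
The pair `(x, y)` denotes the unit square `[x, x+1] × [y, y+1]` of the plane: `x` is the number of
its column (from the left) and `y` the number of its row (from the bottom), both counted from `0`.
A pair of natural numbers is also used for a lattice point (a vertex) of the plane. -/

/-- The board `F` is contained in the `n × n` array whose bottom left corner is the origin. -/
def InArray (n : ℕ) (F : YoungDiagram) : Prop :=
  ∀ c ∈ F, c.1 < n ∧ c.2 < n

/-- The squares of `S` inside the rectangle `[0, a] × [0, b]`, where `V = (a, b)`;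
this is `S ∩ Γ(V)`. -/
def restrict (S : Finset (ℕ × ℕ)) (V : ℕ × ℕ) : Finset (ℕ × ℕ) :=
  S.filter fun c => c.1 < V.1 ∧ c.2 < V.2

open Classical in
/-- The vertices `V_0, …, V_{2n}` of the border of the board `F` in the `n × n` array, starting
at `V_0 = (0, n)`.  From `(a, b)` the border goes south if `0 < b` and the square `(a, b - 1)` to the
right of that south step is not in `F`, and it goes east otherwise. -/
noncomputable def border (n : ℕ) (F : YoungDiagram) : ℕ → ℕ × ℕ
  | 0 => (0, n)
  | i + 1 =>
    if 0 < (border n F i).2 ∧ ((border n F i).1, (border n F i).2 - 1) ∉ F then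
      ((border n F i).1, (border n F i).2 - 1)
    else
      ((border n F i).1 + 1, (border n F i).2)

/-- Height of a lattice point `V = (x, y)` relative to the antidiagonal `y = n - x`. -/
def heightAt (n : ℕ) (V : ℕ × ℕ) : ℤ := (V.1 : ℤ) + (V.2 : ℤ) - (n : ℤ)

/-- `F ∈ 𝓕_n`: the board `F` has exactly `n` non-empty rows and exactly `n` non-empty columns, and
its border from `(0, n)` to `(n, 0)` stays weakly above the line `y = n - x`. -/
structure IsDyckBoard (n : ℕ) (F : YoungDiagram) : Prop where
  inArray : InArray n F
  columns_nonempty : ∀ x < n, (x, 0) ∈ F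
  rows_nonempty : ∀ y < n, (0, y) ∈ F
  above_diagonal : ∀ i ≤ 2 * n, 0 ≤ heightAt n (border n F i)

/-! ### Full rook placements and pattern avoidance -/

/-- `R` is a full rook placement on `F`: a set of squares of `F` such that each (non-empty) row
and each (non-empty) column of `F` contains exactly one element of `R`. -/
structure IsFullPlacement (F : YoungDiagram) (R : Finset (ℕ × ℕ)) : Prop where
  subset : R ⊆ F.cells
  column : ∀ x, (x, 0) ∈ F → ∃! y, (x, y) ∈ R
  row : ∀ y, (0, y) ∈ F → ∃! x, (x, y) ∈ R

/-- The permutation determined by the squares `S` (no two in the same row or column), after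
discarding empty rows and columns, contains the pattern `τ`: there are squares
`c 0, …, c (k-1)` of `S`, listed from left to right, whose rows are in the same relative order as
`τ 0, …, τ (k-1)`. -/
def ContainsPattern {k : ℕ} (S : Finset (ℕ × ℕ)) (τ : Equiv.Perm (Fin k)) : Prop :=
  ∃ c : Fin k → ℕ × ℕ, (∀ a, c a ∈ S) ∧
    (∀ a b, a < b → (c a).1 < (c b).1) ∧
    (∀ a b, (c a).2 < (c b).2 ↔ τ a < τ b)

/-- The rooks `R` on `F` avoid `τ`: for every vertex `V` of the border of `F`, the permutation
given by `R ∩ Γ(V)` does not contain `τ`. -/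
def Avoids {k : ℕ} (n : ℕ) (F : YoungDiagram) (R : Finset (ℕ × ℕ)) (τ : Equiv.Perm (Fin k)) :
    Prop :=
  ∀ i ≤ 2 * n, ¬ ContainsPattern (restrict R (border n F i)) τ

/-- The set of full rook placements on `F` that avoid `τ`. -/
def placementsAvoiding {k : ℕ} (n : ℕ) (F : YoungDiagram) (τ : Equiv.Perm (Fin k)) :
    Set (Finset (ℕ × ℕ)) :=
  {R | IsFullPlacement F R ∧ Avoids n F R τ}

/-- Shape-Wilf-equivalence of patterns: for every Ferrers board (in every `n × n` array), the
numbers of full rook placements avoiding the two patterns agree. -/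
def ShapeWilfEquivalent {k l : ℕ} (σ : Equiv.Perm (Fin k)) (τ : Equiv.Perm (Fin l)) : Prop :=
  ∀ (n : ℕ) (F : YoungDiagram), InArray n F →
    (placementsAvoiding n F σ).ncard = (placementsAvoiding n F τ).ncard

/-- The pattern `321`, in one-line notation with values counted from `0`. -/
def pattern321 : Equiv.Perm (Fin 3) where
  toFun := ![2, 1, 0]
  invFun := ![2, 1, 0]
  left_inv := by decide
  right_inv := by decide

/-- The pattern `213`, in one-line notation with values counted from `0`. -/
def pattern213 : Equiv.Perm (Fin 3) where
  toFun := ![1, 0, 2]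
  invFun := ![1, 0, 2]
  left_inv := by decide
  right_inv := by decide

/-- `T` is an increasing sequence of squares: of any two, one is strictly to the right of and
strictly above the other. -/
def IsIncreasing (T : Finset (ℕ × ℕ)) : Prop :=
  ∀ p ∈ T, ∀ q ∈ T, p ≠ q → (p.1 < q.1 ∧ p.2 < q.2) ∨ (q.1 < p.1 ∧ q.2 < p.2)

open Classical in
/-- The length of the longest increasing sequence in `S`. -/
noncomputable def longestIncreasing (S : Finset (ℕ × ℕ)) : ℕ :=
  (S.powerset.filter IsIncreasing).sup Finset.card

/-- The minimal Ferrers board `F_R` containing the squares `R`. -/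
def minimalBoard (R : Finset (ℕ × ℕ)) : YoungDiagram where
  cells := R.biUnion Finset.Iic
  isLowerSet := by
    intro a b hba ha
    simp only [Finset.coe_biUnion, Set.mem_iUnion, Finset.mem_coe, Finset.mem_Iic] at ha ⊢
    obtain ⟨r, hr, har⟩ := ha
    exact ⟨r, hr, hba.trans har⟩

theorem minimalBoard_isLeast (R : Finset (ℕ × ℕ)) :
    IsLeast {G : YoungDiagram | R ⊆ G.cells} (minimalBoard R) := by
  refine ⟨fun r hr => ?_, fun G hG c hc => ?_⟩
  · exact Finset.mem_biUnion.mpr ⟨r, hr, Finset.mem_Iic.mpr le_rfl⟩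
  · obtain ⟨r, hr, hcr⟩ := Finset.mem_biUnion.mp hc
    exact G.isLowerSet (Finset.mem_Iic.mp hcr) (hG hr)

/-! ### Dyck paths -/

/-- Dyck paths of semilength `n`.  They are drawn from `(0, n)` to `(n, 0)`, the letter `U`
being an east step and the letter `D` a south step; the defining condition of a Dyck word says
that the path stays weakly above the line `y = n - x`. -/
abbrev DyckPath (n : ℕ) : Type := {w : DyckWord // w.semilength = n}

/-- The vertex of the Dyck path reached from `(0, n)` after `i` steps. -/
def DyckPath.vertex {n : ℕ} (D : DyckPath n) (i : ℕ) : ℕ × ℕ :=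
  ((D.1.toList.take i).count DyckStep.U, n - (D.1.toList.take i).count DyckStep.D)

/-- The height sequence of a Dyck path. -/
def DyckPath.height {n : ℕ} (D : DyckPath n) (i : ℕ) : ℤ := heightAt n (D.vertex i)

/-- `D` is the border of the board `F`. -/
def IsBorder {n : ℕ} (D : DyckPath n) (F : YoungDiagram) : Prop :=
  ∀ i ≤ 2 * n, D.vertex i = border n F i

/-- `D₀` never goes above `D₁`.  After `i` steps both paths are on the line `y = x + n - i`,
perpendicular to `y = n - x`, so that it suffices to compare heights. -/
def NeverAbove {n : ℕ} (D₀ D₁ : DyckPath n) : Prop :=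
  ∀ i ≤ 2 * n, D₀.height i ≤ D₁.height i

/-- The set of pairs (bottom path, top path) of noncrossing Dyck paths of semilength `n` whose
top path is the border of `F`. -/
def dyckPairs (n : ℕ) (F : YoungDiagram) : Set (DyckPath n × DyckPath n) :=
  {P | NeverAbove P.1 P.2 ∧ IsBorder P.2 F}

/-! ### Matchings -/

/-- Perfect matchings of the `2n` points `0, …, 2n - 1`: sets of pairs `(i, j)` with `i < j` such
that each point is in exactly one of the pairs. -/
structure PerfectMatching (n : ℕ) where
  pairs : Finset (Fin (2 * n) × Fin (2 * n))
  fst_lt_snd : ∀ p ∈ pairs, p.1 < p.2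
  covers : ∀ v, ∃! p, p ∈ pairs ∧ (p.1 = v ∨ p.2 = v)

namespace PerfectMatching

variable {n : ℕ}

def openers (M : PerfectMatching n) : Finset (Fin (2 * n)) := M.pairs.image Prod.fst

def closers (M : PerfectMatching n) : Finset (Fin (2 * n)) := M.pairs.image Prod.snd

/-- The lattice path of `M` starts at `(0, n)` and has an east step for each opener and a south
step for each closer; this is its vertex after the first `i` points have been read. -/
def pathVertex (M : PerfectMatching n) (i : ℕ) : ℕ × ℕ :=
  ((M.openers.filter fun v => v.val < i).card, n - (M.closers.filter fun v => v.val < i).card)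

/-- `M` has shape `F`: the lattice path of `M` is the border of `F`. -/
def HasShape (M : PerfectMatching n) (F : YoungDiagram) : Prop :=
  ∀ i ≤ 2 * n, M.pathVertex i = border n F i

/-- The column lying below the east step of the opener `i`. -/
def column (M : PerfectMatching n) (i : Fin (2 * n)) : ℕ :=
  (M.openers.filter fun v => v < i).card

/-- The row lying to the left of the south step of the closer `j`. -/
def row (M : PerfectMatching n) (j : Fin (2 * n)) : ℕ :=
  (M.closers.filter fun v => j < v).card

/-- The rooks associated with `M`: for each pair `(i, j)` of `M`, one in the column of `i` and the
row of `j`. -/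
def rooks (M : PerfectMatching n) : Finset (ℕ × ℕ) :=
  M.pairs.image fun p => (M.column p.1, M.row p.2)

end PerfectMatching

/-- The set of matchings of shape `F` that avoid `τ`, i.e. the preimage under `κ`, which sends a
matching to its shape and its rooks, of the set of `τ`-avoiding full rook placements on `F`. -/
def matchingsAvoiding {k : ℕ} (n : ℕ) (F : YoungDiagram) (τ : Equiv.Perm (Fin k)) :
    Set (PerfectMatching n) :=
  {M | M.HasShape F ∧ M.rooks ∈ placementsAvoiding n F τ}

/-- The map `κ` from `τ`-avoiding matchings of shape `F` to `τ`-avoiding full rook placements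
on `F`. -/
def kappa {k : ℕ} (n : ℕ) (F : YoungDiagram) (τ : Equiv.Perm (Fin k))
    (M : matchingsAvoiding n F τ) : placementsAvoiding n F τ :=
  ⟨M.1.rooks, M.2.2⟩

end FerrersMatching

open FerrersMatching

/-!
For each of the two patterns, a placement that avoids it is encoded by a Dyck path below the border,
but the encodings and the reasons for their being bijective are different.

**321.** At a lattice point `V` under the border let `ℓ` be the length of the longest increasing
sequence in `R ∩ Γ(V)` and `m` the number of its rooks (`stats`).  If `R` avoids 321, then
`(ℓ, m - ℓ)` is a partition with at most two rows, namely the one that the Robinson-Schensted correspondence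
associates with `R ∩ Γ(V)`.  The four values at the corners of a unit square and the presence of
a rook in this square satisfy a local rule (`LocalRule`, `localRule_stats`), Fomin's rule restricted to
two rows.  It needs no general theory: a rook to the left of an empty square and a rook below it
form a descent, so `ℓ` at the top right corner is the maximum of the values at the two adjacent
corners, and a third row appears exactly if some rook lies between these two rooks, in which
case neither of them lengthens an increasing sequence (`longestIncreasing_eq_of_middle`,
`longestIncreasing_lt_of_no_middle`).  The rule can be solved in both directions.  Solving it from
the border towards the origin shows that the values on the border determine `R`
(`IsTripleFree.eq_of_stats_eq`), and that every admissible sequence of values on the border extends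
to a growth diagram (`exists_growthDiagram`), whose rooks form a placement with these statistics
(`exists_isTripleFree`).  For a full placement `m` is the height of the border at `V`, so only `ℓ` is
free; the inequalities `m / 2 ≤ ℓ ≤ m` and the unit steps of `ℓ` say that `2ℓ - m` is the height
sequence of a Dyck path that is nowhere above the border.

**213.** The last element of an occurrence of 213 lies above and to the right of the other two, hence
the shape of the board does not matter for avoidance.  A placement avoids 213 and has minimal board
`G` if and only if, read from right to left, each column of `G` has its rook in the highest row
that is still available (`IsGreedy`).  Such a placement is unique (`IsGreedy.eq`), and it exists
because column `x` of a Dyck board has at least `n - x` squares (`IsDyckBoard.exists_isGreedy`).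
So these placements correspond to Dyck boards `G ≤ F`.

**Matchings.** The openers and closers of a matching of shape `F` are the east and the south steps
of the border, so `κ` is a bijection onto the full placements (`kappa_bijective`).

**Shape-Wilf-equivalence.** A board with a full placement has as many rows as columns, and counting
the rooks below a border vertex shows that it is a Dyck board (`IsFullPlacement.isDyckBoard`).
Avoidance does not depend on the size of the array, so the two bijections apply.
-/

namespace FerrersMatching

/-! ### The border of a board -/

/-- The rectangle `[0, a] × [0, b]` lies in the union of `F` and the coordinate axes. -/
def IsVertex (F : YoungDiagram) (a b : ℕ) : Prop :=
  a = 0 ∨ b = 0 ∨ (a - 1, b - 1) ∈ F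

/-- The lattice point `(a, b)` lies on the boundary of `F`, which includes the parts of the
coordinate axes outside of `F`. -/
def OnBorder (F : YoungDiagram) (a b : ℕ) : Prop :=
  (a, b) ∉ F ∧ IsVertex F a b

theorem isVertex_succ {F : YoungDiagram} {a b : ℕ} :
    IsVertex F (a + 1) (b + 1) ↔ (a, b) ∈ F := by
  simp [IsVertex]

theorem IsVertex.mono {F : YoungDiagram} {a b a' b' : ℕ} (h : IsVertex F a b) (ha : a' ≤ a)
    (hb : b' ≤ b) : IsVertex F a' b' := by
  unfold IsVertex at *
  by_cases h1 : a' = 0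
  · exact Or.inl h1
  by_cases h2 : b' = 0
  · exact Or.inr (Or.inl h2)
  rcases h with h | h | h
  · omega
  · omega
  · exact Or.inr (Or.inr (F.up_left_mem (by omega) (by omega) h))

theorem OnBorder.eq_of_add_eq {F : YoungDiagram} {a b a' b' : ℕ} (h : OnBorder F a b)
    (h' : OnBorder F a' b') (e : a + b' = a' + b) : a = a' ∧ b = b' := by
  have key : ∀ {a b a' b' : ℕ}, OnBorder F a b → OnBorder F a' b' → a + b' = a' + b →
      ¬ a < a' := by
    intro a b a' b' h h' e hlt
    have := h'.2.mono (a' := a + 1) (b' := b + 1) (by omega) (by omega)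
    exact h.1 (isVertex_succ.1 this)
  have h1 := key h h' e
  have h2 := key h' h e.symm
  omega

theorem border_spec {n : ℕ} {F : YoungDiagram} (hF : InArray n F) :
    ∀ i ≤ 2 * n, (border n F i).1 + n = (border n F i).2 + i ∧ (border n F i).1 ≤ n ∧
      (border n F i).2 ≤ n ∧ OnBorder F (border n F i).1 (border n F i).2 := by
  intro i
  induction i with
  | zero =>
    intro _
    refine ⟨by simp [border], by simp [border], by simp [border], fun h => ?_, Or.inl rfl⟩
    have := (hF _ h).2
    simp [border] at this
  | succ i ih =>
    intro hi
    obtain ⟨h1, h2, h3, h4⟩ := ih (by omega)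
    rw [border]
    generalize border n F i = V at *
    obtain ⟨a, b⟩ := V
    dsimp only at *
    split_ifs with hs
    · obtain ⟨hb, hs⟩ := hs
      refine ⟨by dsimp only; omega, h2, by dsimp only; omega, hs, h4.2.mono le_rfl (by simp)⟩
    · have hE : b = 0 ∨ (a, b - 1) ∈ F := by
        rcases Nat.eq_zero_or_pos b with h | h
        · exact Or.inl h
        · exact Or.inr (by_contra fun h' => hs ⟨h, h'⟩)
      refine ⟨by dsimp only; omega, ?_, h3, fun h => h4.1 (F.up_left_mem (by simp) le_rfl h),
        Or.inr (by simpa using hE)⟩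
      dsimp only
      rcases hE with h | h
      · omega
      · exact (hF _ h).1

theorem onBorder_border {n : ℕ} {F : YoungDiagram} (hF : InArray n F) {i : ℕ} (hi : i ≤ 2 * n) :
    OnBorder F (border n F i).1 (border n F i).2 :=
  (border_spec hF i hi).2.2.2

/-- Every line `x - y = i - n` meets the boundary of `F` only once, in the `i`-th vertex of the
border. -/
theorem border_eq_of_onBorder {n : ℕ} {F : YoungDiagram} (hF : InArray n F) {a b i : ℕ}
    (hi : i ≤ 2 * n) (e : a + n = b + i) (h : OnBorder F a b) : border n F i = (a, b) := by
  obtain ⟨h1, -, -, h4⟩ := border_spec hF i hi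
  have := h4.eq_of_add_eq h (by omega)
  exact Prod.ext this.1 this.2

theorem border_eq_of_onBorder' {n : ℕ} {F : YoungDiagram} (hF : InArray n F) {a b : ℕ}
    (ha : a ≤ n) (hb : b ≤ n) (h : OnBorder F a b) : border n F (a + n - b) = (a, b) :=
  border_eq_of_onBorder hF (by omega) (by omega) h

theorem border_last {n : ℕ} {F : YoungDiagram} (hF : InArray n F) :
    border n F (2 * n) = (n, 0) := by
  refine border_eq_of_onBorder hF le_rfl (by omega) ⟨fun h => ?_, Or.inr (Or.inl rfl)⟩
  have := (hF _ h).1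
  simp at this

theorem mem_iff_border {n : ℕ} {F : YoungDiagram} (hF : InArray n F) {x y : ℕ} (hx : x < n)
    (hy : y < n) : (x, y) ∈ F ↔ x < (border n F (x + n - y)).1 := by
  obtain ⟨h1, h2, h3, h4⟩ := border_spec hF (x + n - y) (by omega)
  constructor
  · intro h
    by_contra hlt
    exact h4.1 (F.up_left_mem (by omega) (by omega) h)
  · intro h
    exact isVertex_succ.1 (h4.2.mono (by omega) (by omega))

theorem border_step (n : ℕ) (F : YoungDiagram) (i : ℕ) :
    ((border n F (i + 1)).1 = (border n F i).1 + 1 ∧ (border n F (i + 1)).2 = (border n F i).2) ∨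
      ((border n F (i + 1)).1 = (border n F i).1 ∧
        (border n F (i + 1)).2 + 1 = (border n F i).2) := by
  rw [border]
  split_ifs with h
  · right
    refine ⟨rfl, ?_⟩
    dsimp only
    omega
  · exact Or.inl ⟨rfl, rfl⟩

theorem border_fst_le_of_le {n : ℕ} {F G : YoungDiagram} (hF : InArray n F) (hGF : G ≤ F)
    {i : ℕ} (hi : i ≤ 2 * n) : (border n G i).1 ≤ (border n F i).1 := by
  have hG : InArray n G := fun c hc => hF c (hGF hc)
  obtain ⟨h1, -, -, h4⟩ := border_spec hF i hi
  obtain ⟨g1, -, -, g4⟩ := border_spec hG i hi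
  by_contra hlt
  exact h4.1 (hGF (isVertex_succ.1 (g4.2.mono (by omega) (by omega))))

theorem le_of_border_fst_le {n : ℕ} {F G : YoungDiagram} (hF : InArray n F) (hG : InArray n G)
    (h : ∀ i ≤ 2 * n, (border n G i).1 ≤ (border n F i).1) : G ≤ F := by
  rintro ⟨x, y⟩ hc
  obtain ⟨hx, hy⟩ := hG _ hc
  exact (mem_iff_border hF hx hy).2
    (lt_of_lt_of_le ((mem_iff_border hG hx hy).1 hc) (h _ (by dsimp only at *; omega)))

theorem eq_of_border_eq {n : ℕ} {F G : YoungDiagram} (hF : InArray n F) (hG : InArray n G)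
    (h : ∀ i ≤ 2 * n, border n F i = border n G i) : F = G :=
  le_antisymm (le_of_border_fst_le hG hF fun i hi => by rw [h i hi])
    (le_of_border_fst_le hF hG fun i hi => by rw [h i hi])

/-! ### Full placements and their number of rooks below a border vertex -/

theorem mem_restrict {S : Finset (ℕ × ℕ)} {a b : ℕ} {c : ℕ × ℕ} :
    c ∈ restrict S (a, b) ↔ c ∈ S ∧ c.1 < a ∧ c.2 < b := by
  simp [restrict]

theorem restrict_mono {S : Finset (ℕ × ℕ)} {a b a' b' : ℕ} (ha : a ≤ a') (hb : b ≤ b') :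
    restrict S (a, b) ⊆ restrict S (a', b') := by
  intro c hc
  rw [mem_restrict] at *
  exact ⟨hc.1, by omega, by omega⟩

/-- Pattern containment is only an issue for the squares of the board, whatever array the board
is placed in. -/
theorem avoids_iff {k n : ℕ} {F : YoungDiagram} (hF : InArray n F) {R : Finset (ℕ × ℕ)}
    {τ : Equiv.Perm (Fin (k + 1))} :
    Avoids n F R τ ↔ ∀ x y, (x, y) ∈ F → ¬ ContainsPattern (restrict R (x + 1, y + 1)) τ := by
  constructor
  · rintro h x y hxy ⟨c, h1, h2⟩
    obtain ⟨hx, hy⟩ := hF _ hxy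
    dsimp only at hx hy
    obtain ⟨e, -⟩ := border_spec hF (x + n - y) (by omega)
    have h0 := (mem_iff_border hF hx hy).1 hxy
    exact h (x + n - y) (by omega)
      ⟨c, fun a => restrict_mono (by omega) (by omega) (h1 a), h2⟩
  · rintro h i hi ⟨c, h1, h2⟩
    obtain ⟨-, -, -, h4⟩ := border_spec hF i hi
    have hc := mem_restrict.1 (h1 0)
    rcases h4.2 with h0 | h0 | h0
    · omega
    · omega
    · refine h _ _ h0 ⟨c, ?_, h2⟩
      rwa [Nat.sub_add_cancel (by omega), Nat.sub_add_cancel (by omega)]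

/-- No two squares of `S` are in the same column or in the same row. -/
def NonAttacking (S : Finset (ℕ × ℕ)) : Prop :=
  Set.InjOn Prod.fst (S : Set (ℕ × ℕ)) ∧ Set.InjOn Prod.snd (S : Set (ℕ × ℕ))

theorem NonAttacking.mono {S T : Finset (ℕ × ℕ)} (h : NonAttacking T) (hST : S ⊆ T) :
    NonAttacking S :=
  ⟨h.1.mono (by exact_mod_cast hST), h.2.mono (by exact_mod_cast hST)⟩

theorem IsFullPlacement.mem {F : YoungDiagram} {R : Finset (ℕ × ℕ)} (h : IsFullPlacement F R)
    {c : ℕ × ℕ} (hc : c ∈ R) : c ∈ F :=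
  YoungDiagram.mem_cells _ |>.1 (h.subset hc)

theorem IsFullPlacement.nonAttacking {F : YoungDiagram} {R : Finset (ℕ × ℕ)}
    (h : IsFullPlacement F R) : NonAttacking R := by
  constructor
  · rintro ⟨x, y⟩ hc ⟨x', y'⟩ hd (rfl : x = x')
    have := (h.column x (F.up_left_mem le_rfl (Nat.zero_le _) (h.mem hc))).unique hc hd
    rw [this]
  · rintro ⟨x, y⟩ hc ⟨x', y'⟩ hd (rfl : y = y')
    have := (h.row y (F.up_left_mem (Nat.zero_le _) le_rfl (h.mem hc))).unique hc hd
    rw [this]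

theorem IsFullPlacement.card_filter_fst {n : ℕ} {F : YoungDiagram} {R : Finset (ℕ × ℕ)}
    (h : IsFullPlacement F R) (hF : ∀ x, (x, 0) ∈ F ↔ x < n) (a : ℕ) :
    (R.filter fun c => a ≤ c.1).card = n - a := by
  rw [← Nat.card_Ico, ← Finset.card_image_of_injOn (f := Prod.fst)
    (h.nonAttacking.1.mono (by intro c hc; simpa using (Finset.mem_filter.1 hc).1))]
  congr 1
  ext x
  simp only [Finset.mem_image, Finset.mem_filter, Finset.mem_Ico]
  constructor
  · rintro ⟨⟨x, y⟩, ⟨hc, ha⟩, rfl⟩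
    exact ⟨ha, (hF _).1 (F.up_left_mem le_rfl (Nat.zero_le _) (h.mem hc))⟩
  · rintro ⟨ha, hx⟩
    obtain ⟨y, hy, -⟩ := h.column x ((hF x).2 hx)
    exact ⟨(x, y), ⟨hy, ha⟩, rfl⟩

theorem IsFullPlacement.card_filter_snd {n : ℕ} {F : YoungDiagram} {R : Finset (ℕ × ℕ)}
    (h : IsFullPlacement F R) (hF : ∀ y, (0, y) ∈ F ↔ y < n) (b : ℕ) :
    (R.filter fun c => b ≤ c.2).card = n - b := by
  rw [← Nat.card_Ico, ← Finset.card_image_of_injOn (f := Prod.snd)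
    (h.nonAttacking.2.mono (by intro c hc; simpa using (Finset.mem_filter.1 hc).1))]
  congr 1
  ext y
  simp only [Finset.mem_image, Finset.mem_filter, Finset.mem_Ico]
  constructor
  · rintro ⟨⟨x, y⟩, ⟨hc, ha⟩, rfl⟩
    exact ⟨ha, (hF _).1 (F.up_left_mem (Nat.zero_le _) le_rfl (h.mem hc))⟩
  · rintro ⟨ha, hy⟩
    obtain ⟨x, hx, -⟩ := h.row y ((hF y).2 hy)
    exact ⟨(x, y), ⟨hx, ha⟩, rfl⟩

/-- Of the `n` rooks, `n - a` are in a column to the right of the border vertex `(a, b)`, and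
`n - b` others are in a row above it. -/
theorem IsFullPlacement.card_restrict {n : ℕ} {F : YoungDiagram} {R : Finset (ℕ × ℕ)}
    (h : IsFullPlacement F R) (hc : ∀ x, (x, 0) ∈ F ↔ x < n) (hr : ∀ y, (0, y) ∈ F ↔ y < n)
    {a b : ℕ} (ha : a ≤ n) (hb : b ≤ n) (hab : OnBorder F a b) :
    (restrict R (a, b)).card + n = a + b := by
  have e : R = restrict R (a, b) ∪ ((R.filter fun c => a ≤ c.1) ∪ R.filter fun c => b ≤ c.2) := by
    ext c
    simp only [Finset.mem_union, Finset.mem_filter, mem_restrict]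
    constructor
    · intro hc
      by_cases h1 : a ≤ c.1
      · simp [hc, h1]
      · by_cases h2 : b ≤ c.2
        · simp [hc, h2]
        · exact Or.inl ⟨hc, by omega, by omega⟩
    · tauto
  have d1 : Disjoint (R.filter fun c => a ≤ c.1) (R.filter fun c => b ≤ c.2) := by
    rw [Finset.disjoint_left]
    intro c h1 h2
    rw [Finset.mem_filter] at h1 h2
    exact hab.1 (F.up_left_mem h1.2 h2.2 (h.mem h1.1))
  have d2 : Disjoint (restrict R (a, b))
      ((R.filter fun c => a ≤ c.1) ∪ R.filter fun c => b ≤ c.2) := by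
    rw [Finset.disjoint_left]
    intro c h1 h2
    rw [mem_restrict] at h1
    rw [Finset.mem_union, Finset.mem_filter, Finset.mem_filter] at h2
    omega
  have e0 := h.card_filter_fst hc 0
  have e1 := h.card_filter_fst hc a
  have e2 := h.card_filter_snd hr b
  have e3 : R.card = n := by simpa using e0
  have e4 := congrArg Finset.card e
  rw [Finset.card_union_of_disjoint d2, Finset.card_union_of_disjoint d1, e1, e2, e3] at e4
  omega

theorem IsDyckBoard.column_iff {n : ℕ} {F : YoungDiagram} (hF : IsDyckBoard n F) (x : ℕ) :
    (x, 0) ∈ F ↔ x < n :=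
  ⟨fun h => (hF.inArray _ h).1, hF.columns_nonempty x⟩

theorem IsDyckBoard.row_iff {n : ℕ} {F : YoungDiagram} (hF : IsDyckBoard n F) (y : ℕ) :
    (0, y) ∈ F ↔ y < n :=
  ⟨fun h => (hF.inArray _ h).2, hF.rows_nonempty y⟩

/-- A board with `n` columns and `n` rows that has a full placement is a Dyck board. -/
theorem IsFullPlacement.isDyckBoard {n : ℕ} {F : YoungDiagram} {R : Finset (ℕ × ℕ)}
    (h : IsFullPlacement F R) (hc : ∀ x, (x, 0) ∈ F ↔ x < n) (hr : ∀ y, (0, y) ∈ F ↔ y < n) :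
    IsDyckBoard n F := by
  have hF : InArray n F := fun c hcF =>
    ⟨(hc _).1 (F.up_left_mem le_rfl (Nat.zero_le _) hcF),
      (hr _).1 (F.up_left_mem (Nat.zero_le _) le_rfl hcF)⟩
  refine ⟨hF, fun x hx => (hc x).2 hx, fun y hy => (hr y).2 hy, fun i hi => ?_⟩
  obtain ⟨-, h2, h3, h4⟩ := border_spec hF i hi
  have := h.card_restrict hc hr h2 h3 h4
  unfold heightAt
  omega

theorem IsFullPlacement.rowLen_eq_colLen {F : YoungDiagram} {R : Finset (ℕ × ℕ)}
    (h : IsFullPlacement F R) : F.rowLen 0 = F.colLen 0 := by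
  have e1 := h.card_filter_fst (n := F.colLen 0) (fun x => YoungDiagram.mem_iff_lt_colLen) 0
  have e2 := h.card_filter_snd (n := F.rowLen 0) (fun x => YoungDiagram.mem_iff_lt_rowLen) 0
  simp at e1 e2
  omega

/-- The border has an east step in each column, at the height of the column. -/
theorem onBorder_rowLen (F : YoungDiagram) (x : ℕ) :
    OnBorder F x (F.rowLen x) ∧ OnBorder F (x + 1) (F.rowLen x) := by
  have hb : F.rowLen x = 0 ∨ (x, F.rowLen x - 1) ∈ F := by
    rw [YoungDiagram.mem_iff_lt_rowLen]
    omega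
  have h : (x, F.rowLen x) ∉ F := fun h => by simpa using YoungDiagram.mem_iff_lt_rowLen.1 h
  have hv : IsVertex F (x + 1) (F.rowLen x) := Or.inr (by simpa using hb)
  exact ⟨⟨h, hv.mono (Nat.le_succ x) le_rfl⟩,
    fun h' => h (F.up_left_mem (Nat.le_succ x) le_rfl h'), hv⟩

/-- The border has a south step in each row, at the end of the row. -/
theorem onBorder_colLen (F : YoungDiagram) (y : ℕ) :
    OnBorder F (F.colLen y) y ∧ OnBorder F (F.colLen y) (y + 1) := by
  have ha : F.colLen y = 0 ∨ (F.colLen y - 1, y) ∈ F := by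
    rw [YoungDiagram.mem_iff_lt_colLen]
    omega
  have h : (F.colLen y, y) ∉ F := fun h => by simpa using YoungDiagram.mem_iff_lt_colLen.1 h
  have hv : IsVertex F (F.colLen y) (y + 1) :=
    ha.imp id fun h => Or.inr (by simpa using h)
  exact ⟨⟨h, hv.mono le_rfl (Nat.le_succ y)⟩,
    fun h' => h (F.up_left_mem le_rfl (Nat.le_succ y) h'), hv⟩

theorem rowLen_le {n : ℕ} {F : YoungDiagram} (hF : InArray n F) (x : ℕ) : F.rowLen x ≤ n := by
  by_contra h
  exact lt_irrefl n (hF (x, n) (YoungDiagram.mem_iff_lt_rowLen.2 (by omega))).2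

theorem colLen_le {n : ℕ} {F : YoungDiagram} (hF : InArray n F) (y : ℕ) : F.colLen y ≤ n := by
  by_contra h
  exact lt_irrefl n (hF (n, y) (YoungDiagram.mem_iff_lt_colLen.2 (by omega))).1

/-- If the number of rooks below each border vertex is what it is for a full placement, then the
placement is full: each unit step of the border changes this number. -/
theorem isFullPlacement_of_card_restrict {n : ℕ} {F : YoungDiagram} (hF : InArray n F)
    {R : Finset (ℕ × ℕ)} (hRF : R ⊆ F.cells) (hR : NonAttacking R)
    (hcard : ∀ a b, a ≤ n → b ≤ n → OnBorder F a b → (restrict R (a, b)).card + n = a + b) :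
    IsFullPlacement F R := by
  refine ⟨hRF, fun x hx => ?_, fun y hy => ?_⟩
  · have hxn := (hF _ hx).1
    have hbn := rowLen_le hF x
    obtain ⟨h1, h2⟩ := onBorder_rowLen F x
    have e1 := hcard _ _ (by omega) hbn h1
    have e2 := hcard _ _ (by dsimp only at hxn; omega) hbn h2
    obtain ⟨⟨x', y⟩, hc, hc'⟩ := Finset.exists_mem_notMem_of_card_lt_card
      (show (restrict R (x, F.rowLen x)).card < (restrict R (x + 1, F.rowLen x)).card by omega)
    rw [mem_restrict] at hc hc'
    dsimp only at hc hc'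
    obtain rfl : x' = x := by
      by_contra hne
      exact hc' ⟨hc.1, by omega, hc.2.2⟩
    exact ⟨y, hc.1, fun y' hy' => congrArg Prod.snd (hR.1 hy' hc.1 rfl)⟩
  · have hyn := (hF _ hy).2
    have han := colLen_le hF y
    obtain ⟨h1, h2⟩ := onBorder_colLen F y
    have e1 := hcard _ _ han (by omega) h1
    have e2 := hcard _ _ han (by dsimp only at hyn; omega) h2
    obtain ⟨⟨x, y'⟩, hc, hc'⟩ := Finset.exists_mem_notMem_of_card_lt_card
      (show (restrict R (F.colLen y, y)).card < (restrict R (F.colLen y, y + 1)).card by omega)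
    rw [mem_restrict] at hc hc'
    dsimp only at hc hc'
    obtain rfl : y' = y := by
      by_contra hne
      exact hc' ⟨hc.1, hc.2.1, by omega⟩
    exact ⟨x, hc.1, fun x' hx' => congrArg Prod.fst (hR.2 hx' hc.1 rfl)⟩

/-! ### Longest increasing sequences -/

theorem IsIncreasing.subset {S T : Finset (ℕ × ℕ)} (hT : IsIncreasing T) (h : S ⊆ T) :
    IsIncreasing S :=
  fun p hp q hq => hT p (h hp) q (h hq)

theorem IsIncreasing.card_le {S T : Finset (ℕ × ℕ)} (hT : IsIncreasing T) (h : T ⊆ S) :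
    T.card ≤ longestIncreasing S := by
  classical
  unfold longestIncreasing
  exact Finset.le_sup (f := Finset.card)
    (Finset.mem_filter.2 ⟨Finset.mem_powerset.2 h, hT⟩)

theorem exists_card_eq_longestIncreasing (S : Finset (ℕ × ℕ)) :
    ∃ T ⊆ S, IsIncreasing T ∧ T.card = longestIncreasing S := by
  classical
  unfold longestIncreasing
  obtain ⟨T, hT, e⟩ := Finset.exists_mem_eq_sup (S.powerset.filter IsIncreasing)
    ⟨∅, by simp [IsIncreasing]⟩ Finset.card
  rw [Finset.mem_filter, Finset.mem_powerset] at hT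
  exact ⟨T, hT.1, hT.2, e.symm⟩

theorem longestIncreasing_mono {S T : Finset (ℕ × ℕ)} (h : S ⊆ T) :
    longestIncreasing S ≤ longestIncreasing T := by
  obtain ⟨U, hU, hi, e⟩ := exists_card_eq_longestIncreasing S
  exact e ▸ hi.card_le (hU.trans h)

theorem longestIncreasing_le_card (S : Finset (ℕ × ℕ)) : longestIncreasing S ≤ S.card := by
  obtain ⟨U, hU, -, e⟩ := exists_card_eq_longestIncreasing S
  exact e ▸ Finset.card_le_card hU

theorem longestIncreasing_insert_le (c : ℕ × ℕ) (S : Finset (ℕ × ℕ)) :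
    longestIncreasing (insert c S) ≤ longestIncreasing S + 1 := by
  obtain ⟨U, hU, hi, e⟩ := exists_card_eq_longestIncreasing (insert c S)
  have h1 := (hi.subset (Finset.erase_subset c U)).card_le (S := S)
    (Finset.subset_insert_iff.1 hU)
  have h2 := Finset.pred_card_le_card_erase (s := U) (a := c)
  omega

theorem IsIncreasing.insert {T : Finset (ℕ × ℕ)} {c : ℕ × ℕ} (hT : IsIncreasing T)
    (h : ∀ t ∈ T, t.1 < c.1 ∧ t.2 < c.2) : IsIncreasing (insert c T) := by
  intro p hp q hq hne
  rw [Finset.mem_insert] at hp hq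
  rcases hp with rfl | hp <;> rcases hq with rfl | hq
  · exact absurd rfl hne
  · exact Or.inr (h q hq)
  · exact Or.inl (h p hp)
  · exact hT p hp q hq hne

/-- An increasing sequence is extended by a square to the right of and above its elements. -/
theorem IsIncreasing.card_lt {S T : Finset (ℕ × ℕ)} {c : ℕ × ℕ} (hT : IsIncreasing T)
    (hTS : T ⊆ S) (hc : c ∈ S) (h : ∀ t ∈ T, t.1 < c.1 ∧ t.2 < c.2) :
    T.card < longestIncreasing S := by
  have hcT : c ∉ T := fun hcT => lt_irrefl _ (h c hcT).1
  have := (hT.insert h).card_le (Finset.insert_subset hc hTS)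
  rwa [Finset.card_insert_of_notMem hcT] at this

/-! ### The pattern 321 -/

/-- `S` contains a decreasing sequence of length three. -/
def HasDecreasingTriple (S : Finset (ℕ × ℕ)) : Prop :=
  ∃ p ∈ S, ∃ q ∈ S, ∃ r ∈ S, p.1 < q.1 ∧ q.1 < r.1 ∧ r.2 < q.2 ∧ q.2 < p.2

theorem containsPattern_321_iff {S : Finset (ℕ × ℕ)} :
    ContainsPattern S pattern321 ↔ HasDecreasingTriple S := by
  constructor
  · rintro ⟨c, h1, h2, h3⟩
    exact ⟨c 0, h1 0, c 1, h1 1, c 2, h1 2, h2 0 1 (by decide), h2 1 2 (by decide),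
      (h3 2 1).2 (by decide), (h3 1 0).2 (by decide)⟩
  · rintro ⟨p, hp, q, hq, r, hr, h1, h2, h3, h4⟩
    refine ⟨![p, q, r], ?_, ?_, ?_⟩
    · intro a
      fin_cases a <;> simpa
    · intro a b
      fin_cases a <;> fin_cases b <;> simp <;> omega
    · intro a b
      fin_cases a <;> fin_cases b <;> simp [pattern321] <;> omega

/-! ### Growth around a unit square -/

/-- The length `ℓ` of the longest increasing sequence in `S` and the number `m` of elements of `S`.
For a set without decreasing triples, `(ℓ, m - ℓ)` is the shape that the Robinson-Schensted
correspondence associates with `S`. -/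
noncomputable def stats (S : Finset (ℕ × ℕ)) : ℕ × ℕ := (longestIncreasing S, S.card)

/-- The pair `(ℓ, m)` encodes a partition `(ℓ, m - ℓ)` with at most two parts. -/
def IsTwoRow (u : ℕ × ℕ) : Prop := u.1 ≤ u.2 ∧ u.2 ≤ 2 * u.1

/-- The partitions encoded by `u` and `v` are equal, or `v` is obtained from `u` by adding a box to
the first or to the second row. -/
def GrowsTo (u v : ℕ × ℕ) : Prop :=
  v = u ∨ v = (u.1 + 1, u.2 + 1) ∨ v = (u.1, u.2 + 1)

/-- The local rule that relates the statistics at the four corners of a unit square (`sw` bottom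
left, `nw` top left, `se` bottom right, `ne` top right) to the presence `r` of a rook in it.  In the
last case there are both a rook to the left of and a rook below the square; then `nw` and `se` are
not both obtained from `sw` by adding a box to the second row, as this would produce a third row
in `ne`. -/
def LocalRule (sw nw se ne : ℕ × ℕ) (r : Prop) : Prop :=
  (r ∧ nw = sw ∧ se = sw ∧ ne = (sw.1 + 1, sw.2 + 1)) ∨
  (¬ r ∧ nw = sw ∧ ne = se ∧ GrowsTo sw se) ∨
  (¬ r ∧ se = sw ∧ ne = nw ∧ GrowsTo sw nw) ∨
  (¬ r ∧ nw.2 = sw.2 + 1 ∧ se.2 = sw.2 + 1 ∧ ne = (sw.1 + 1, sw.2 + 2) ∧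
    (nw.1 = sw.1 + 1 ∧ (se.1 = sw.1 ∨ se.1 = sw.1 + 1) ∨ nw.1 = sw.1 ∧ se.1 = sw.1 + 1))

theorem LocalRule.rook_iff {sw nw se ne : ℕ × ℕ} {r : Prop} (h : LocalRule sw nw se ne r) :
    r ↔ ne.1 = nw.1 + 1 ∧ ne.1 = se.1 + 1 ∧ ne.2 = nw.2 + 1 ∧ ne.2 = se.2 + 1 := by
  simp only [LocalRule, Prod.ext_iff] at h
  rcases h with ⟨hr, h⟩ | ⟨hr, h⟩ | ⟨hr, h⟩ | ⟨hr, h⟩ <;> simp only [hr, true_iff, false_iff] <;>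
    omega

theorem LocalRule.forward {sw nw se ne ne' : ℕ × ℕ} {r : Prop} (h : LocalRule sw nw se ne r)
    (h' : LocalRule sw nw se ne' r) : ne = ne' := by
  simp only [LocalRule, GrowsTo, Prod.ext_iff] at *
  by_cases hr : r <;>
  · simp only [hr, not_true_eq_false, not_false_eq_true, true_and, false_and, or_false,
      false_or] at h h'
    omega

theorem LocalRule.backward {sw sw' nw se ne : ℕ × ℕ} {r r' : Prop}
    (h : LocalRule sw nw se ne r) (h' : LocalRule sw' nw se ne r') :
    sw = sw' ∧ (r ↔ r') := by
  have e : r ↔ r' := h.rook_iff.trans h'.rook_iff.symm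
  refine ⟨?_, e⟩
  simp only [LocalRule, GrowsTo, Prod.ext_iff, ← e] at *
  by_cases hr : r <;>
  · simp only [hr, not_true_eq_false, not_false_eq_true, true_and, false_and, or_false,
      false_or] at h h'
    omega

theorem LocalRule.isTwoRow {sw nw se ne : ℕ × ℕ} {r : Prop} (h : LocalRule sw nw se ne r)
    (h1 : IsTwoRow sw) (h2 : IsTwoRow nw) (h3 : IsTwoRow se) : IsTwoRow ne := by
  simp only [LocalRule, GrowsTo, Prod.ext_iff, IsTwoRow] at *
  omega

/-- The local rule can be solved for the bottom left corner and the presence of a rook. -/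
theorem exists_localRule {nw se ne : ℕ × ℕ} (h1 : IsTwoRow nw) (h2 : IsTwoRow se)
    (h3 : IsTwoRow ne) (h4 : GrowsTo nw ne) (h5 : GrowsTo se ne) :
    ∃ sw : ℕ × ℕ, ∃ r : Prop, LocalRule sw nw se ne r ∧ IsTwoRow sw ∧ GrowsTo sw nw ∧
      GrowsTo sw se := by
  by_cases hn : ne = nw
  · exact ⟨se, False, Or.inr (Or.inr (Or.inl ⟨id, rfl, hn, hn ▸ h5⟩)), h2, hn ▸ h5, Or.inl rfl⟩
  by_cases hs : ne = se
  · exact ⟨nw, False, Or.inr (Or.inl ⟨id, rfl, hs, hs ▸ h4⟩), h1, Or.inl rfl, hs ▸ h4⟩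
  by_cases hr : ne.1 = nw.1 + 1 ∧ ne.1 = se.1 + 1
  · simp only [GrowsTo, Prod.ext_iff] at h4 h5 hn hs
    have e : se = nw := Prod.ext (by omega) (by omega)
    exact ⟨nw, True, Or.inl ⟨trivial, rfl, e, Prod.ext (by dsimp only; omega)
      (by dsimp only; omega)⟩, h1, Or.inl rfl, Or.inl e⟩
  · simp only [GrowsTo, Prod.ext_iff, IsTwoRow] at *
    refine ⟨(ne.1 - 1, ne.2 - 2), False, Or.inr (Or.inr (Or.inr ⟨id, ?_⟩)), ?_⟩
    · simp only [Prod.ext_iff]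
      omega
    · omega

/-- Adding at most one square to `S` changes the statistics by at most one box. -/
theorem stats_growsTo {S T : Finset (ℕ × ℕ)} (hST : S ⊆ T) (hcard : T.card ≤ S.card + 1) :
    GrowsTo (stats S) (stats T) := by
  rcases Nat.lt_or_ge S.card T.card with h | h
  · obtain ⟨c, hcT, hcS⟩ := Finset.exists_mem_notMem_of_card_lt_card h
    have e : insert c S = T := by
      refine Finset.eq_of_subset_of_card_le (Finset.insert_subset hcT hST) ?_
      rw [Finset.card_insert_of_notMem hcS]
      omega
    have h1 := longestIncreasing_mono hST
    have h2 := longestIncreasing_insert_le c S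
    rw [e] at h2
    simp only [GrowsTo, stats, Prod.ext_iff]
    omega
  · rw [Finset.eq_of_subset_of_card_le hST h]
    exact Or.inl rfl

theorem fst_eq_of_notMem_restrict {R : Finset (ℕ × ℕ)} {a b : ℕ} {c : ℕ × ℕ}
    (h : c ∈ restrict R (a + 1, b)) (h' : c ∉ restrict R (a, b)) : c.1 = a := by
  rw [mem_restrict] at h h'
  by_contra
  exact h' ⟨h.1, by omega⟩

theorem snd_eq_of_notMem_restrict {R : Finset (ℕ × ℕ)} {a b : ℕ} {c : ℕ × ℕ}
    (h : c ∈ restrict R (a, b + 1)) (h' : c ∉ restrict R (a, b)) : c.2 = b := by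
  rw [mem_restrict] at h h'
  by_contra
  exact h' ⟨h.1, by omega⟩

theorem card_restrict_succ_left {R : Finset (ℕ × ℕ)} {a b : ℕ}
    (h : NonAttacking (restrict R (a + 1, b))) :
    (restrict R (a + 1, b)).card ≤ (restrict R (a, b)).card + 1 := by
  classical
  have h1 : (restrict R (a + 1, b) \ restrict R (a, b)).card ≤ 1 := by
    rw [Finset.card_le_one]
    intro c hc d hd
    rw [Finset.mem_sdiff] at hc hd
    refine h.1 hc.1 hd.1 ?_
    rw [fst_eq_of_notMem_restrict hc.1 hc.2, fst_eq_of_notMem_restrict hd.1 hd.2]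
  have := Finset.card_le_card_sdiff_add_card (s := restrict R (a + 1, b)) (t := restrict R (a, b))
  omega

theorem card_restrict_succ_right {R : Finset (ℕ × ℕ)} {a b : ℕ}
    (h : NonAttacking (restrict R (a, b + 1))) :
    (restrict R (a, b + 1)).card ≤ (restrict R (a, b)).card + 1 := by
  classical
  have h1 : (restrict R (a, b + 1) \ restrict R (a, b)).card ≤ 1 := by
    rw [Finset.card_le_one]
    intro c hc d hd
    rw [Finset.mem_sdiff] at hc hd
    refine h.2 hc.1 hd.1 ?_
    rw [snd_eq_of_notMem_restrict hc.1 hc.2, snd_eq_of_notMem_restrict hd.1 hd.2]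
  have := Finset.card_le_card_sdiff_add_card (s := restrict R (a, b + 1)) (t := restrict R (a, b))
  omega

theorem stats_growsTo_left {R : Finset (ℕ × ℕ)} {a b : ℕ}
    (h : NonAttacking (restrict R (a + 1, b))) :
    GrowsTo (stats (restrict R (a, b))) (stats (restrict R (a + 1, b))) :=
  stats_growsTo (restrict_mono (Nat.le_succ a) le_rfl) (card_restrict_succ_left h)

theorem stats_growsTo_right {R : Finset (ℕ × ℕ)} {a b : ℕ}
    (h : NonAttacking (restrict R (a, b + 1))) :
    GrowsTo (stats (restrict R (a, b))) (stats (restrict R (a, b + 1))) :=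
  stats_growsTo (restrict_mono le_rfl (Nat.le_succ b)) (card_restrict_succ_right h)

theorem restrict_succ_succ_of_mem {R : Finset (ℕ × ℕ)} {a b : ℕ} (hc : (a, b) ∈ R)
    (h1 : restrict R (a, b + 1) = restrict R (a, b))
    (h2 : restrict R (a + 1, b) = restrict R (a, b)) :
    restrict R (a + 1, b + 1) = insert (a, b) (restrict R (a, b)) := by
  ext ⟨x, y⟩
  have h1 := Finset.ext_iff.1 h1 (x, y)
  have h2 := Finset.ext_iff.1 h2 (x, y)
  simp only [mem_restrict, Finset.mem_insert, Prod.mk.injEq] at *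
  constructor
  · rintro ⟨h, h3, h4⟩
    by_cases hx : x = a
    · by_cases hy : y = b
      · exact Or.inl ⟨hx, hy⟩
      · exact absurd (h2.1 ⟨h, h3, by omega⟩).2.1 (by omega)
    · exact Or.inr (h1.1 ⟨h, by omega, h4⟩)
  · rintro (⟨rfl, rfl⟩ | ⟨h, h3, h4⟩)
    · exact ⟨hc, by omega⟩
    · exact ⟨h, by omega⟩

theorem restrict_succ_succ_of_notMem {R : Finset (ℕ × ℕ)} {a b : ℕ} (hc : (a, b) ∉ R) :
    restrict R (a + 1, b + 1) = restrict R (a, b + 1) ∪ restrict R (a + 1, b) := by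
  ext ⟨x, y⟩
  simp only [mem_restrict, Finset.mem_union]
  constructor
  · rintro ⟨h, h3, h4⟩
    by_cases hx : x = a
    · by_cases hy : y = b
      · exact absurd h (by rwa [hx, hy])
      · exact Or.inr ⟨h, by omega⟩
    · exact Or.inl ⟨h, by omega⟩
  · rintro (⟨h, h3, h4⟩ | ⟨h, h3, h4⟩)
    · exact ⟨h, by omega⟩
    · exact ⟨h, by omega⟩

/-- A rook to the left of an empty unit square and a rook below it form a descent, so that an
increasing sequence uses at most one of them. -/
theorem longestIncreasing_restrict_of_notMem {R : Finset (ℕ × ℕ)} {a b : ℕ} (hc : (a, b) ∉ R) :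
    longestIncreasing (restrict R (a + 1, b + 1)) =
      max (longestIncreasing (restrict R (a, b + 1)))
        (longestIncreasing (restrict R (a + 1, b))) := by
  refine le_antisymm ?_ (max_le (longestIncreasing_mono (restrict_mono (Nat.le_succ a) le_rfl))
    (longestIncreasing_mono (restrict_mono le_rfl (Nat.le_succ b))))
  obtain ⟨T, hT, hi, e⟩ := exists_card_eq_longestIncreasing (restrict R (a + 1, b + 1))
  rw [← e]
  by_cases h1 : T ⊆ restrict R (a, b + 1)
  · exact le_max_of_le_left (hi.card_le h1)
  by_cases h2 : T ⊆ restrict R (a + 1, b)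
  · exact le_max_of_le_right (hi.card_le h2)
  obtain ⟨p, hp, hp'⟩ := Finset.not_subset.1 h1
  obtain ⟨q, hq, hq'⟩ := Finset.not_subset.1 h2
  have hpR := hT hp
  have hqR := hT hq
  rw [mem_restrict] at hpR hqR hp' hq'
  have h3 : ¬ (p.1 = a ∧ p.2 = b) := by
    rintro ⟨rfl, rfl⟩
    exact hc hpR.1
  have h4 := hi p hp q hq (by
    rintro rfl
    simp only [hpR.1, true_and] at hp' hq'
    omega)
  have h5 : p.1 = a := by
    by_contra
    exact hp' ⟨hpR.1, by omega⟩
  have h6 : q.2 = b := by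
    by_contra
    exact hq' ⟨hqR.1, by omega⟩
  omega

/-- If there is a rook `x` that is to the right of a rook `p` at the left of the unit square and
above a rook `q` below the unit square, then neither `p` nor `q` increases the length of the
longest increasing sequence. -/
theorem longestIncreasing_eq_of_middle {R : Finset (ℕ × ℕ)} {a b : ℕ} {p x q : ℕ × ℕ}
    (h1 : ¬ HasDecreasingTriple (restrict R (a, b + 1)))
    (h2 : ¬ HasDecreasingTriple (restrict R (a + 1, b)))
    (hp : p ∈ restrict R (a, b + 1)) (hpb : p.2 = b) (hq : q ∈ restrict R (a + 1, b))
    (hqa : q.1 = a) (hx : x ∈ restrict R (a, b)) (hpx : p.1 < x.1) (hqx : q.2 < x.2)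
    (hU : NonAttacking (restrict R (a, b + 1))) (hW : NonAttacking (restrict R (a + 1, b))) :
    longestIncreasing (restrict R (a, b + 1)) = longestIncreasing (restrict R (a, b)) ∧
      longestIncreasing (restrict R (a + 1, b)) = longestIncreasing (restrict R (a, b)) := by
  have sU : restrict R (a, b) ⊆ restrict R (a, b + 1) := restrict_mono le_rfl (Nat.le_succ b)
  have sW : restrict R (a, b) ⊆ restrict R (a + 1, b) := restrict_mono (Nat.le_succ a) le_rfl
  constructor
  · refine le_antisymm ?_ (longestIncreasing_mono sU)
    obtain ⟨T, hT, hi, e⟩ := exists_card_eq_longestIncreasing (restrict R (a, b + 1))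
    rw [← e]
    by_cases hpT : p ∈ T
    · have key : ∀ t ∈ T.erase p, t ∈ restrict R (a, b) ∧ t.1 < x.1 ∧ t.2 < x.2 := by
        intro t ht
        rw [Finset.mem_erase] at ht
        have htR := hT ht.2
        have h3 := hi t ht.2 p hpT ht.1
        rw [mem_restrict] at htR
        have htX : t ∈ restrict R (a, b) := mem_restrict.2 ⟨htR.1, by omega⟩
        refine ⟨htX, by omega, ?_⟩
        by_contra hlt
        have hne : x.2 ≠ t.2 := fun h => by
          have := hU.2 (sU hx) (sU htX) h
          subst this
          omega
        exact h2 ⟨t, sW htX, x, sW hx, q, hq, by omega,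
          by rw [hqa]; exact (mem_restrict.1 hx).2.1, hqx, by omega⟩
      have := (hi.subset (Finset.erase_subset p T)).card_lt (fun t ht => (key t ht).1) hx
        (fun t ht => (key t ht).2)
      rw [Finset.card_erase_of_mem hpT] at this
      omega
    · refine hi.card_le fun t ht => ?_
      have htR := hT ht
      have hne : t.2 ≠ p.2 := fun h => hpT (hU.2 htR hp h ▸ ht)
      rw [mem_restrict] at htR ⊢
      exact ⟨htR.1, by omega⟩
  · refine le_antisymm ?_ (longestIncreasing_mono sW)
    obtain ⟨T, hT, hi, e⟩ := exists_card_eq_longestIncreasing (restrict R (a + 1, b))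
    rw [← e]
    by_cases hqT : q ∈ T
    · have key : ∀ t ∈ T.erase q, t ∈ restrict R (a, b) ∧ t.1 < x.1 ∧ t.2 < x.2 := by
        intro t ht
        rw [Finset.mem_erase] at ht
        have htR := hT ht.2
        have h3 := hi t ht.2 q hqT ht.1
        rw [mem_restrict] at htR
        have htX : t ∈ restrict R (a, b) := mem_restrict.2 ⟨htR.1, by omega⟩
        refine ⟨htX, ?_, by omega⟩
        by_contra hlt
        have hne : x.1 ≠ t.1 := fun h => by
          have := hW.1 (sW hx) (sW htX) h
          subst this
          omega
        exact h1 ⟨p, hp, x, sU hx, t, sU htX, hpx, by omega, by omega,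
          by rw [hpb]; exact (mem_restrict.1 hx).2.2⟩
      have := (hi.subset (Finset.erase_subset q T)).card_lt (fun t ht => (key t ht).1) hx
        (fun t ht => (key t ht).2)
      rw [Finset.card_erase_of_mem hqT] at this
      omega
    · refine hi.card_le fun t ht => ?_
      have htR := hT ht
      have hne : t.1 ≠ q.1 := fun h => hqT (hW.1 htR hq h ▸ ht)
      rw [mem_restrict] at htR ⊢
      exact ⟨htR.1, by omega⟩

/-- Conversely, without a decreasing triple that ends in rooks to the left of and below the unit
square, one of these rooks extends a given longest increasing sequence. -/
theorem longestIncreasing_lt_of_no_middle {R : Finset (ℕ × ℕ)} {a b : ℕ} {p q : ℕ × ℕ}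
    (hΛ : NonAttacking (restrict R (a + 1, b + 1)))
    (h : ¬ HasDecreasingTriple (restrict R (a + 1, b + 1)))
    (hp : p ∈ restrict R (a, b + 1)) (hpb : p.2 = b) (hq : q ∈ restrict R (a + 1, b))
    (hqa : q.1 = a) :
    longestIncreasing (restrict R (a, b)) < longestIncreasing (restrict R (a, b + 1)) ∨
      longestIncreasing (restrict R (a, b)) < longestIncreasing (restrict R (a + 1, b)) := by
  have sU : restrict R (a, b) ⊆ restrict R (a, b + 1) := restrict_mono le_rfl (Nat.le_succ b)
  have sW : restrict R (a, b) ⊆ restrict R (a + 1, b) := restrict_mono (Nat.le_succ a) le_rfl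
  have tU : restrict R (a, b + 1) ⊆ restrict R (a + 1, b + 1) :=
    restrict_mono (Nat.le_succ a) le_rfl
  have tW : restrict R (a + 1, b) ⊆ restrict R (a + 1, b + 1) :=
    restrict_mono le_rfl (Nat.le_succ b)
  obtain ⟨T, hT, hi, e⟩ := exists_card_eq_longestIncreasing (restrict R (a, b))
  rw [← e]
  by_cases hall : ∀ t ∈ T, t.1 < p.1
  · refine Or.inl (hi.card_lt (hT.trans sU) hp fun t ht => ⟨hall t ht, ?_⟩)
    rw [hpb]
    exact (mem_restrict.1 (hT ht)).2.2
  · push Not at hall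
    obtain ⟨t, ht, hpt⟩ := hall
    have htX := mem_restrict.1 (hT ht)
    have ne1 : p.1 ≠ t.1 := fun h => by
      have := hΛ.1 (tU hp) (tU (sU (hT ht))) h
      subst this
      omega
    have ne2 : t.2 ≠ q.2 := fun h => by
      have := hΛ.2 (tU (sU (hT ht))) (tW hq) h
      subst this
      omega
    have htq : t.2 < q.2 := by
      by_contra hlt
      exact h ⟨p, tU hp, t, tU (sU (hT ht)), q, tW hq, by omega, by omega, by omega, by omega⟩
    refine Or.inr (hi.card_lt (hT.trans sW) hq fun s hs => ?_)
    have hsX := mem_restrict.1 (hT hs)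
    refine ⟨by omega, ?_⟩
    by_cases hst : s = t
    · rwa [hst]
    · rcases hi s hs t ht hst with h3 | h3
      · omega
      · have ne3 : s.2 ≠ q.2 := fun h => by
          have := hΛ.2 (tU (sU (hT hs))) (tW hq) h
          subst this
          omega
        by_contra hlt
        exact h ⟨p, tU hp, s, tU (sU (hT hs)), q, tW hq, by omega, by omega, by omega, by omega⟩

/-- The statistics of a placement without decreasing triples satisfy the local rule. -/
theorem localRule_stats {R : Finset (ℕ × ℕ)} {a b : ℕ}
    (hΛ : NonAttacking (restrict R (a + 1, b + 1)))
    (h : ¬ HasDecreasingTriple (restrict R (a + 1, b + 1))) :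
    LocalRule (stats (restrict R (a, b))) (stats (restrict R (a, b + 1)))
      (stats (restrict R (a + 1, b))) (stats (restrict R (a + 1, b + 1))) ((a, b) ∈ R) := by
  have sU : restrict R (a, b) ⊆ restrict R (a, b + 1) := restrict_mono le_rfl (Nat.le_succ b)
  have sW : restrict R (a, b) ⊆ restrict R (a + 1, b) := restrict_mono (Nat.le_succ a) le_rfl
  have tU : restrict R (a, b + 1) ⊆ restrict R (a + 1, b + 1) :=
    restrict_mono (Nat.le_succ a) le_rfl
  have tW : restrict R (a + 1, b) ⊆ restrict R (a + 1, b + 1) :=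
    restrict_mono le_rfl (Nat.le_succ b)
  have gU := stats_growsTo_right (hΛ.mono tU)
  have gW := stats_growsTo_left (hΛ.mono tW)
  by_cases hc : (a, b) ∈ R
  · have hcΛ : (a, b) ∈ restrict R (a + 1, b + 1) :=
      mem_restrict.2 ⟨hc, Nat.lt_succ_self a, Nat.lt_succ_self b⟩
    have e1 : restrict R (a, b + 1) = restrict R (a, b) := by
      refine subset_antisymm (fun d hd => ?_) sU
      have hne : d.2 ≠ b := fun hdb => by
        have := hΛ.2 (tU hd) hcΛ hdb
        subst this
        exact lt_irrefl _ (mem_restrict.1 hd).2.1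
      rw [mem_restrict] at hd ⊢
      exact ⟨hd.1, by omega⟩
    have e2 : restrict R (a + 1, b) = restrict R (a, b) := by
      refine subset_antisymm (fun d hd => ?_) sW
      have hne : d.1 ≠ a := fun hda => by
        have := hΛ.1 (tW hd) hcΛ hda
        subst this
        exact lt_irrefl _ (mem_restrict.1 hd).2.2
      rw [mem_restrict] at hd ⊢
      exact ⟨hd.1, by omega⟩
    refine Or.inl ⟨hc, by rw [e1], by rw [e2], ?_⟩
    rw [restrict_succ_succ_of_mem hc e1 e2]
    have hcX : (a, b) ∉ restrict R (a, b) := fun h => lt_irrefl _ (mem_restrict.1 h).2.1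
    obtain ⟨T, hT, hi, e⟩ := exists_card_eq_longestIncreasing (restrict R (a, b))
    have h1 := hi.card_lt (hT.trans (Finset.subset_insert (a, b) _))
      (Finset.mem_insert_self _ _) fun t ht => (mem_restrict.1 (hT ht)).2
    have h2 := longestIncreasing_insert_le (a, b) (restrict R (a, b))
    simp only [stats, Finset.card_insert_of_notMem hcX, Prod.mk.injEq, and_true]
    omega
  · by_cases e1 : restrict R (a, b + 1) = restrict R (a, b)
    · refine Or.inr (Or.inl ⟨hc, by rw [e1], ?_, gW⟩)
      rw [restrict_succ_succ_of_notMem hc, e1, Finset.union_eq_right.2 sW]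
    by_cases e2 : restrict R (a + 1, b) = restrict R (a, b)
    · refine Or.inr (Or.inr (Or.inl ⟨hc, by rw [e2], ?_, gU⟩))
      rw [restrict_succ_succ_of_notMem hc, e2, Finset.union_eq_left.2 sU]
    obtain ⟨p, hp, hpX⟩ := Finset.not_subset.1 fun h => e1 (subset_antisymm h sU)
    obtain ⟨q, hq, hqX⟩ := Finset.not_subset.1 fun h => e2 (subset_antisymm h sW)
    have hlt := longestIncreasing_lt_of_no_middle hΛ h hp (snd_eq_of_notMem_restrict hp hpX) hq
      (fst_eq_of_notMem_restrict hq hqX)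
    have hmax := longestIncreasing_restrict_of_notMem hc
    have hcard := Finset.card_union_add_card_inter (restrict R (a, b + 1)) (restrict R (a + 1, b))
    have hinter : restrict R (a, b + 1) ∩ restrict R (a + 1, b) = restrict R (a, b) := by
      ext c
      simp only [Finset.mem_inter, mem_restrict]
      constructor
      · rintro ⟨⟨h1, h2⟩, h3, h4⟩
        exact ⟨h1, by omega⟩
      · rintro ⟨h1, h2⟩
        exact ⟨⟨h1, by omega⟩, h1, by omega⟩
    rw [← restrict_succ_succ_of_notMem hc, hinter] at hcard
    have c1 := Finset.card_lt_card (Finset.ssubset_iff_subset_ne.2 ⟨sU, Ne.symm e1⟩)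
    have c2 := Finset.card_lt_card (Finset.ssubset_iff_subset_ne.2 ⟨sW, Ne.symm e2⟩)
    simp only [GrowsTo, stats, Prod.ext_iff] at gU gW
    refine Or.inr (Or.inr (Or.inr ⟨hc, ?_⟩))
    simp only [stats, Prod.ext_iff]
    omega

/-- If the local rule holds for some value `ne` at the top right corner, and the placement below
the top left and the bottom right corner is as desired, then it is so below the top right
corner, and `ne` is the value of the statistics there. -/
theorem stats_of_localRule {R : Finset (ℕ × ℕ)} {a b : ℕ} {ne : ℕ × ℕ}
    (hU : NonAttacking (restrict R (a, b + 1))) (hW : NonAttacking (restrict R (a + 1, b)))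
    (h1 : ¬ HasDecreasingTriple (restrict R (a, b + 1)))
    (h2 : ¬ HasDecreasingTriple (restrict R (a + 1, b)))
    (hloc : LocalRule (stats (restrict R (a, b))) (stats (restrict R (a, b + 1)))
      (stats (restrict R (a + 1, b))) ne ((a, b) ∈ R)) :
    NonAttacking (restrict R (a + 1, b + 1)) ∧
      ¬ HasDecreasingTriple (restrict R (a + 1, b + 1)) ∧
      stats (restrict R (a + 1, b + 1)) = ne := by
  have sU : restrict R (a, b) ⊆ restrict R (a, b + 1) := restrict_mono le_rfl (Nat.le_succ b)
  have sW : restrict R (a, b) ⊆ restrict R (a + 1, b) := restrict_mono (Nat.le_succ a) le_rfl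
  suffices H : NonAttacking (restrict R (a + 1, b + 1)) ∧
      ¬ HasDecreasingTriple (restrict R (a + 1, b + 1)) from
    ⟨H.1, H.2, (localRule_stats H.1 H.2).forward hloc⟩
  by_cases hc : (a, b) ∈ R
  · obtain ⟨-, e1, e2, -⟩ : (a, b) ∈ R ∧ _ := by
      simpa only [LocalRule, hc, not_true_eq_false, true_and, false_and, or_false] using hloc
    have e1 := (Finset.eq_of_subset_of_card_le sU (Prod.ext_iff.1 e1).2.le).symm
    have e2 := (Finset.eq_of_subset_of_card_le sW (Prod.ext_iff.1 e2).2.le).symm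
    rw [restrict_succ_succ_of_mem hc e1 e2]
    rw [e1] at hU h1
    have hlt : ∀ d ∈ restrict R (a, b), d.1 < a ∧ d.2 < b := fun d hd => (mem_restrict.1 hd).2
    refine ⟨⟨?_, ?_⟩, ?_⟩
    · rw [Finset.coe_insert, Set.injOn_insert fun h => lt_irrefl _ (hlt _ h).1]
      refine ⟨hU.1, ?_⟩
      rintro ⟨d, hd, hda⟩
      exact absurd (hlt _ hd).1 (by omega)
    · rw [Finset.coe_insert, Set.injOn_insert fun h => lt_irrefl _ (hlt _ h).1]
      refine ⟨hU.2, ?_⟩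
      rintro ⟨d, hd, hda⟩
      exact absurd (hlt _ hd).2 (by omega)
    · rintro ⟨p, hp, q, hq, r, hr, H⟩
      have hp' : p = (a, b) ∨ p.1 < a ∧ p.2 < b := (Finset.mem_insert.1 hp).imp id (hlt p)
      have hq' : q = (a, b) ∨ q.1 < a ∧ q.2 < b := (Finset.mem_insert.1 hq).imp id (hlt q)
      have hr' : r = (a, b) ∨ r.1 < a ∧ r.2 < b := (Finset.mem_insert.1 hr).imp id (hlt r)
      rw [Prod.ext_iff] at hp' hq' hr'
      dsimp only at hp' hq' hr'
      refine h1 ⟨p, Finset.mem_of_mem_insert_of_ne hp ?_, q,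
        Finset.mem_of_mem_insert_of_ne hq ?_, r, Finset.mem_of_mem_insert_of_ne hr ?_, H⟩ <;>
      · rw [Ne, Prod.ext_iff]
        dsimp only
        omega
  · have hmem : ∀ d ∈ restrict R (a + 1, b + 1), (d.2 = b → d ∈ restrict R (a, b + 1)) ∧
        (d.2 < b → d ∈ restrict R (a + 1, b)) ∧ (d.1 = a → d ∈ restrict R (a + 1, b)) ∧
        (d.1 < a → d ∈ restrict R (a, b + 1)) ∧ d.1 ≤ a ∧ d.2 ≤ b := by
      intro d hd
      rw [mem_restrict] at hd
      have hne : ¬ (d.1 = a ∧ d.2 = b) := by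
        rintro ⟨rfl, rfl⟩
        exact hc hd.1
      simp only [mem_restrict, hd.1, true_and]
      omega
    refine ⟨⟨?_, ?_⟩, ?_⟩
    · intro c hc d hd hcd
      obtain ⟨-, -, c3, c4, c5, -⟩ := hmem c hc
      obtain ⟨-, -, d3, d4, d5, -⟩ := hmem d hd
      rcases c5.eq_or_lt with h | h
      · exact hW.1 (c3 h) (d3 (hcd ▸ h)) hcd
      · exact hU.1 (c4 h) (d4 (hcd ▸ h)) hcd
    · intro c hc d hd hcd
      obtain ⟨c1, c2, -, -, -, c6⟩ := hmem c hc
      obtain ⟨d1, d2, -, -, -, d6⟩ := hmem d hd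
      rcases c6.eq_or_lt with h | h
      · exact hU.2 (c1 h) (d1 (hcd ▸ h)) hcd
      · exact hW.2 (c2 h) (d2 (hcd ▸ h)) hcd
    · rintro ⟨p, hp, x, hx, q, hq, H1, H2, H3, H4⟩
      obtain ⟨p1, p2, p3, p4, p5, p6⟩ := hmem p hp
      obtain ⟨x1, x2, x3, x4, x5, x6⟩ := hmem x hx
      obtain ⟨q1, q2, q3, q4, q5, q6⟩ := hmem q hq
      by_cases hpb : p.2 = b
      · by_cases hqa : q.1 = a
        · have hxX : x ∈ restrict R (a, b) :=
            mem_restrict.2 ⟨(mem_restrict.1 hx).1, by omega, by omega⟩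
          obtain ⟨E1, E2⟩ := longestIncreasing_eq_of_middle h1 h2 (p1 hpb) hpb (q3 hqa) hqa hxX
            H1 H3 hU hW
          have c1 := Finset.card_lt_card (Finset.ssubset_iff_subset_ne.2 ⟨sU, fun e => by
            have := mem_restrict.1 (e ▸ p1 hpb)
            omega⟩)
          have c2 := Finset.card_lt_card (Finset.ssubset_iff_subset_ne.2 ⟨sW, fun e => by
            have := mem_restrict.1 (e ▸ q3 hqa)
            omega⟩)
          simp only [LocalRule, stats, Prod.ext_iff] at hloc
          omega
        · exact h1 ⟨p, p4 (by omega), x, x4 (by omega), q, q4 (by omega), H1, H2, H3, H4⟩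
      · exact h2 ⟨p, p2 (by omega), x, x2 (by omega), q, q2 (by omega), H1, H2, H3, H4⟩

/-! ### Growth diagrams: placements without decreasing triples from their border statistics -/

/-- `R` is a partial rook placement on `F` without a decreasing triple below a border vertex. -/
structure IsTripleFree (F : YoungDiagram) (R : Finset (ℕ × ℕ)) : Prop where
  subset : R ⊆ F.cells
  nonAttacking : NonAttacking R
  avoids : ∀ x y, (x, y) ∈ F → ¬ HasDecreasingTriple (restrict R (x + 1, y + 1))

theorem IsTripleFree.localRule {F : YoungDiagram} {R : Finset (ℕ × ℕ)} (h : IsTripleFree F R)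
    {a b : ℕ} (hab : (a, b) ∈ F) :
    LocalRule (stats (restrict R (a, b))) (stats (restrict R (a, b + 1)))
      (stats (restrict R (a + 1, b))) (stats (restrict R (a + 1, b + 1))) ((a, b) ∈ R) :=
  localRule_stats (h.nonAttacking.mono (Finset.filter_subset _ _)) (h.avoids a b hab)

theorem stats_empty : stats ∅ = (0, 0) := by
  have := longestIncreasing_le_card ∅
  simp only [Finset.card_empty, Nat.le_zero] at this
  simp [stats, this]

theorem restrict_zero_left (R : Finset (ℕ × ℕ)) (b : ℕ) : restrict R (0, b) = ∅ := by
  simp [restrict]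

theorem restrict_zero_right (R : Finset (ℕ × ℕ)) (a : ℕ) : restrict R (a, 0) = ∅ := by
  simp [restrict]

/-- The longest increasing sequence has at least half of the elements. -/
theorem IsTripleFree.isTwoRow {F : YoungDiagram} {R : Finset (ℕ × ℕ)} (h : IsTripleFree F R)
    (a : ℕ) : ∀ b, IsVertex F a b → IsTwoRow (stats (restrict R (a, b))) := by
  induction a with
  | zero => intro b _; simp [restrict_zero_left, stats_empty, IsTwoRow]
  | succ a iha =>
    intro b
    induction b with
    | zero => intro _; simp [restrict_zero_right, stats_empty, IsTwoRow]
    | succ b ihb =>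
      intro hv
      exact (h.localRule (isVertex_succ.1 hv)).isTwoRow
        (iha b (hv.mono (Nat.le_succ a) (Nat.le_succ b))) (iha (b + 1) (hv.mono (Nat.le_succ a)
          le_rfl)) (ihb (hv.mono le_rfl (Nat.le_succ b)))

theorem IsVertex.onBorder_or_mem {F : YoungDiagram} {a b : ℕ} (h : IsVertex F a b) :
    OnBorder F a b ∨ (a, b) ∈ F := by
  by_cases hab : (a, b) ∈ F
  · exact Or.inr hab
  · exact Or.inl ⟨hab, h⟩

/-- The statistics along the border determine the placement: the local rule can be solved from
the top right to the bottom left. -/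
theorem IsTripleFree.eq_of_stats_eq {n : ℕ} {F : YoungDiagram} (hF : InArray n F)
    {R R' : Finset (ℕ × ℕ)} (h : IsTripleFree F R) (h' : IsTripleFree F R')
    (e : ∀ a b, a ≤ n → b ≤ n → OnBorder F a b →
      stats (restrict R (a, b)) = stats (restrict R' (a, b))) : R = R' := by
  have key : ∀ k a b, a ≤ n → b ≤ n → (n - a) + (n - b) = k → IsVertex F a b →
      stats (restrict R (a, b)) = stats (restrict R' (a, b)) ∧
        ((a, b) ∈ F → ((a, b) ∈ R ↔ (a, b) ∈ R')) := by
    intro k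
    induction k using Nat.strong_induction_on with
    | _ k ih =>
      intro a b ha hb hk hv
      rcases hv.onBorder_or_mem with hab | hab
      · exact ⟨e a b ha hb hab, fun h => absurd h hab.1⟩
      · obtain ⟨han, hbn⟩ := hF _ hab
        dsimp only at han hbn
        have hv1 := isVertex_succ.2 hab
        have l := h.localRule hab
        have l' := h'.localRule hab
        rw [(ih _ (by omega) (a + 1) (b + 1) (by omega) (by omega) rfl hv1).1,
          (ih _ (by omega) (a + 1) b (by omega) (by omega) rfl (hv1.mono le_rfl (by omega))).1,
          (ih _ (by omega) a (b + 1) (by omega) (by omega) rfl (hv1.mono (by omega) le_rfl)).1]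
          at l
        exact ⟨(l.backward l').1, fun _ => (l.backward l').2⟩
  have hmem : ∀ c ∈ F, (c ∈ R ↔ c ∈ R') := by
    rintro ⟨a, b⟩ hab
    obtain ⟨han, hbn⟩ := hF _ hab
    exact (key _ a b han.le hbn.le rfl
      ((isVertex_succ.2 hab).mono (by omega) (by omega))).2 hab
  ext c
  constructor
  · intro hc
    exact (hmem c (YoungDiagram.mem_cells _ |>.1 (h.subset hc))).1 hc
  · intro hc
    exact (hmem c (YoungDiagram.mem_cells _ |>.1 (h'.subset hc))).2 hc

/-- Prescribed statistics along the border extend to all lattice points of the board, such that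
the local rule holds in each of its squares, by solving the rule from the top right to the bottom
left. -/
theorem exists_growthDiagram {n : ℕ} {F : YoungDiagram} (hF : InArray n F) {B : ℕ → ℕ → ℕ × ℕ}
    (h1 : ∀ a b, a ≤ n → b ≤ n → OnBorder F a b → IsTwoRow (B a b))
    (h2 : ∀ a b, a < n → b ≤ n → OnBorder F a b → OnBorder F (a + 1) b →
      GrowsTo (B a b) (B (a + 1) b))
    (h3 : ∀ a b, a ≤ n → b < n → OnBorder F a b → OnBorder F a (b + 1) →
      GrowsTo (B a b) (B a (b + 1))) :
    ∃ g : ℕ → ℕ → ℕ × ℕ, ∃ R ⊆ F.cells,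
      (∀ a b, a ≤ n → b ≤ n → OnBorder F a b → g a b = B a b) ∧
      (∀ a b, a ≤ n → b ≤ n → IsVertex F a b → IsTwoRow (g a b)) ∧
      (∀ a b, a < n → b ≤ n → IsVertex F (a + 1) b → GrowsTo (g a b) (g (a + 1) b)) ∧
      (∀ a b, a ≤ n → b < n → IsVertex F a (b + 1) → GrowsTo (g a b) (g a (b + 1))) ∧
      (∀ a b, (a, b) ∈ F →
        LocalRule (g a b) (g a (b + 1)) (g (a + 1) b) (g (a + 1) (b + 1)) ((a, b) ∈ R)) := by
  classical
  -- The values at the lattice points `(a, b)` with `2n - k ≤ a + b` are constructed by induction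
  -- on `k`.
  have key : ∀ k, ∃ g : ℕ → ℕ → ℕ × ℕ, ∃ r : ℕ × ℕ → Prop,
      (∀ a b, a ≤ n → b ≤ n → OnBorder F a b → g a b = B a b) ∧
      (∀ a b, a ≤ n → b ≤ n → 2 * n ≤ a + b + k → IsVertex F a b → IsTwoRow (g a b)) ∧
      (∀ a b, a < n → b ≤ n → 2 * n ≤ a + b + k → IsVertex F (a + 1) b →
        GrowsTo (g a b) (g (a + 1) b)) ∧
      (∀ a b, a ≤ n → b < n → 2 * n ≤ a + b + k → IsVertex F a (b + 1) →
        GrowsTo (g a b) (g a (b + 1))) ∧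
      (∀ a b, (a, b) ∈ F → 2 * n ≤ a + b + k →
        LocalRule (g a b) (g a (b + 1)) (g (a + 1) b) (g (a + 1) (b + 1)) (r (a, b))) := by
    intro k
    induction k with
    | zero =>
      refine ⟨B, fun _ => False, fun _ _ _ _ _ => rfl, ?_, ?_, ?_, ?_⟩
      · intro a b ha hb hk hv
        rcases hv.onBorder_or_mem with hab | hab
        · exact h1 a b ha hb hab
        · have := hF _ hab
          dsimp only at this
          omega
      · intros; omega
      · intros; omega
      · intro a b hab hk
        have := hF _ hab
        dsimp only at this
        omega
    | succ k ih =>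
      obtain ⟨g, r, g0, g1, g2, g3, g4⟩ := ih
      -- The local rule, solved in all squares on the next antidiagonal.
      have ex : ∀ a b, ∃ sw : ℕ × ℕ, ∃ s : Prop, (a, b) ∈ F → a + b + k + 1 = 2 * n →
          LocalRule sw (g a (b + 1)) (g (a + 1) b) (g (a + 1) (b + 1)) s ∧ IsTwoRow sw ∧
            GrowsTo sw (g a (b + 1)) ∧ GrowsTo sw (g (a + 1) b) := by
        intro a b
        by_cases hab : (a, b) ∈ F ∧ a + b + k + 1 = 2 * n
        · obtain ⟨hab, hk⟩ := hab
          have hn := hF _ hab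
          dsimp only at hn
          have hv := isVertex_succ.2 hab
          have hv1 := hv.mono (Nat.le_succ a) le_rfl
          have hv2 := hv.mono le_rfl (Nat.le_succ b)
          obtain ⟨sw, s, H⟩ := exists_localRule
            (g1 a (b + 1) (by omega) (by omega) (by omega) hv1)
            (g1 (a + 1) b (by omega) (by omega) (by omega) hv2)
            (g1 (a + 1) (b + 1) (by omega) (by omega) (by omega) hv)
            (g2 a (b + 1) (by omega) (by omega) (by omega) hv)
            (g3 (a + 1) b (by omega) (by omega) (by omega) hv)
          exact ⟨sw, s, fun _ _ => H⟩
        · exact ⟨0, False, fun h1 h2 => absurd ⟨h1, h2⟩ hab⟩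
      choose sw s hsw using ex
      set g' : ℕ → ℕ → ℕ × ℕ := fun a b =>
        if (a, b) ∈ F ∧ a + b + k + 1 = 2 * n then sw a b else g a b with hg'
      have old : ∀ a b, a + b + k + 1 ≠ 2 * n → g' a b = g a b := fun a b h =>
        if_neg fun h' => h h'.2
      have new : ∀ a b, (a, b) ∈ F → a + b + k + 1 = 2 * n → g' a b = sw a b := fun a b h h' =>
        if_pos ⟨h, h'⟩
      have bd : ∀ a b, a ≤ n → b ≤ n → OnBorder F a b → g' a b = B a b := fun a b ha hb h =>
        (if_neg fun h' => h.1 h'.1).trans (g0 a b ha hb h)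
      refine ⟨g', fun c => if c.1 + c.2 + k + 1 = 2 * n then s c.1 c.2 else r c, bd, ?_, ?_, ?_,
        ?_⟩
      · intro a b ha hb hk hv
        by_cases hk' : a + b + k + 1 = 2 * n
        · rcases hv.onBorder_or_mem with hab | hab
          · rw [bd a b ha hb hab]
            exact h1 a b ha hb hab
          · rw [new a b hab hk']
            exact (hsw a b hab hk').2.1
        · rw [old a b hk']
          exact g1 a b ha hb (by omega) hv
      · intro a b ha hb hk hv
        have hv' := hv.mono (Nat.le_succ a) le_rfl
        by_cases hk' : a + b + k + 1 = 2 * n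
        · rcases hv'.onBorder_or_mem with hab | hab
          · have hab' : OnBorder F (a + 1) b :=
              ⟨fun h => hab.1 (F.up_left_mem (Nat.le_succ a) le_rfl h), hv⟩
            rw [bd a b ha.le hb hab, bd (a + 1) b ha hb hab']
            exact h2 a b ha hb hab hab'
          · rw [new a b hab hk', old (a + 1) b (by omega)]
            exact (hsw a b hab hk').2.2.2
        · rw [old a b hk', old (a + 1) b (by omega)]
          exact g2 a b ha hb (by omega) hv
      · intro a b ha hb hk hv
        have hv' := hv.mono le_rfl (Nat.le_succ b)
        by_cases hk' : a + b + k + 1 = 2 * n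
        · rcases hv'.onBorder_or_mem with hab | hab
          · have hab' : OnBorder F a (b + 1) :=
              ⟨fun h => hab.1 (F.up_left_mem le_rfl (Nat.le_succ b) h), hv⟩
            rw [bd a b ha hb.le hab, bd a (b + 1) ha hb hab']
            exact h3 a b ha hb hab hab'
          · rw [new a b hab hk', old a (b + 1) (by omega)]
            exact (hsw a b hab hk').2.2.1
        · rw [old a b hk', old a (b + 1) (by omega)]
          exact g3 a b ha hb (by omega) hv
      · intro a b hab hk
        dsimp only
        rw [old a (b + 1) (by omega), old (a + 1) b (by omega), old (a + 1) (b + 1) (by omega)]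
        by_cases hk' : a + b + k + 1 = 2 * n
        · rw [new a b hab hk', if_pos hk']
          exact (hsw a b hab hk').1
        · rw [old a b hk', if_neg hk']
          exact g4 a b hab (by omega)
  obtain ⟨g, r, g0, g1, g2, g3, g4⟩ := key (2 * n)
  refine ⟨g, F.cells.filter r, Finset.filter_subset _ _, g0,
    fun a b ha hb => g1 a b ha hb (by omega), fun a b ha hb => g2 a b ha hb (by omega),
    fun a b ha hb => g3 a b ha hb (by omega), fun a b hab => ?_⟩
  have : (a, b) ∈ F.cells.filter r ↔ r (a, b) := by
    simp [hab]
  rw [this]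
  exact g4 a b hab (by omega)

/-- Every sequence of two-row partitions along the border that starts and ends with the empty
partition, and in which each step to the right or upwards adds at most one box, is given by the
statistics of a placement. -/
theorem exists_isTripleFree {n : ℕ} {F : YoungDiagram} (hF : InArray n F) {B : ℕ → ℕ → ℕ × ℕ}
    (h1 : ∀ a b, a ≤ n → b ≤ n → OnBorder F a b → IsTwoRow (B a b))
    (h2 : ∀ a b, a < n → b ≤ n → OnBorder F a b → OnBorder F (a + 1) b →
      GrowsTo (B a b) (B (a + 1) b))
    (h3 : ∀ a b, a ≤ n → b < n → OnBorder F a b → OnBorder F a (b + 1) →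
      GrowsTo (B a b) (B a (b + 1)))
    (h4 : B 0 n = (0, 0)) (h5 : B n 0 = (0, 0)) :
    ∃ R, IsTripleFree F R ∧
      ∀ a b, a ≤ n → b ≤ n → OnBorder F a b → stats (restrict R (a, b)) = B a b := by
  obtain ⟨g, R, hRF, g0, g1, g2, g3, g4⟩ := exists_growthDiagram hF h1 h2 h3
  have mono : ∀ {u v}, GrowsTo u v → u.2 ≤ v.2 := by
    intro u v h
    simp only [GrowsTo, Prod.ext_iff] at h
    omega
  have zero : ∀ {u}, IsTwoRow u → u.2 = 0 → u = (0, 0) := by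
    intro u h h0
    exact Prod.ext (by simpa [h0] using h.1) h0
  -- The extended statistics vanish on the coordinate axes.
  have left : ∀ b ≤ n, g 0 b = (0, 0) := by
    intro b hb
    refine zero (g1 0 b (Nat.zero_le _) hb (Or.inl rfl)) ?_
    induction hb using Nat.decreasingInduction with
    | self =>
      rw [g0 0 n (Nat.zero_le _) le_rfl ⟨fun h => lt_irrefl _ (hF _ h).2, Or.inl rfl⟩, h4]
    | of_succ b hb ih =>
      have := mono (g3 0 b (Nat.zero_le _) hb (Or.inl rfl))
      omega
  have bottom : ∀ a ≤ n, g a 0 = (0, 0) := by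
    intro a ha
    refine zero (g1 a 0 ha (Nat.zero_le _) (Or.inr (Or.inl rfl))) ?_
    induction ha using Nat.decreasingInduction with
    | self =>
      rw [g0 n 0 le_rfl (Nat.zero_le _)
        ⟨fun h => lt_irrefl _ (hF _ h).1, Or.inr (Or.inl rfl)⟩, h5]
    | of_succ a ha ih =>
      have := mono (g2 a 0 ha (Nat.zero_le _) (Or.inr (Or.inl rfl)))
      omega
  have empty : NonAttacking ∅ ∧ ¬ HasDecreasingTriple ∅ := by
    simp [NonAttacking, HasDecreasingTriple]
  have key : ∀ a, a ≤ n → ∀ b, b ≤ n → IsVertex F a b → NonAttacking (restrict R (a, b)) ∧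
      ¬ HasDecreasingTriple (restrict R (a, b)) ∧ stats (restrict R (a, b)) = g a b := by
    intro a
    induction a with
    | zero =>
      intro _ b hb _
      rw [restrict_zero_left, left b hb, stats_empty]
      exact ⟨empty.1, empty.2, rfl⟩
    | succ a iha =>
      intro ha b
      induction b with
      | zero =>
        intro _ _
        rw [restrict_zero_right, bottom _ ha, stats_empty]
        exact ⟨empty.1, empty.2, rfl⟩
      | succ b ihb =>
        intro hb hv
        obtain ⟨-, -, e1⟩ := iha (by omega) b (by omega) (hv.mono (Nat.le_succ a) (Nat.le_succ b))
        obtain ⟨u1, u2, e2⟩ := iha (by omega) (b + 1) hb (hv.mono (Nat.le_succ a) le_rfl)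
        obtain ⟨w1, w2, e3⟩ := ihb (by omega) (hv.mono le_rfl (Nat.le_succ b))
        have l := g4 a b (isVertex_succ.1 hv)
        rw [← e1, ← e2, ← e3] at l
        exact stats_of_localRule u1 w1 u2 w2 l
  refine ⟨R, ⟨hRF, ?_, ?_⟩, fun a b ha hb hab => ?_⟩
  · -- A row or a column of the board is contained in one of the rectangles considered above.
    have hcell : ∀ c ∈ R, ∀ a b, (a, b) ∈ F → c.1 ≤ a → c.2 ≤ b →
        c ∈ restrict R (a + 1, b + 1) := fun c hc a b _ h1 h2 =>
      mem_restrict.2 ⟨hc, by omega, by omega⟩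
    constructor
    · rintro ⟨x, y⟩ hc ⟨x', y'⟩ hd (rfl : x = x')
      have hm : (x, max y y') ∈ F := by
        rcases max_choice y y' with h | h <;> rw [h]
        · exact YoungDiagram.mem_cells _ |>.1 (hRF hc)
        · exact YoungDiagram.mem_cells _ |>.1 (hRF hd)
      have hn := hF _ hm
      exact (key (x + 1) hn.1 _ hn.2 (isVertex_succ.2 hm)).1.1
        (hcell _ hc _ _ hm le_rfl (le_max_left _ _))
        (hcell _ hd _ _ hm le_rfl (le_max_right _ _)) rfl
    · rintro ⟨x, y⟩ hc ⟨x', y'⟩ hd (rfl : y = y')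
      have hm : (max x x', y) ∈ F := by
        rcases max_choice x x' with h | h <;> rw [h]
        · exact YoungDiagram.mem_cells _ |>.1 (hRF hc)
        · exact YoungDiagram.mem_cells _ |>.1 (hRF hd)
      have hn := hF _ hm
      exact (key _ hn.1 (y + 1) hn.2 (isVertex_succ.2 hm)).1.2
        (hcell _ hc _ _ hm (le_max_left _ _) le_rfl)
        (hcell _ hd _ _ hm (le_max_right _ _) le_rfl) rfl
  · intro x y hxy
    have hn := hF _ hxy
    exact (key (x + 1) hn.1 (y + 1) hn.2 (isVertex_succ.2 hxy)).2.1
  · rw [(key a ha b hb hab.2).2.2, g0 a b ha hb hab]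

/-! ### Dyck paths -/

theorem count_U_add_count_D (l : List DyckStep) :
    l.count DyckStep.U + l.count DyckStep.D = l.length := by
  induction l with
  | nil => rfl
  | cons s l ih =>
    rw [List.count_cons, List.count_cons, List.length_cons]
    cases s <;> simp <;> omega

namespace DyckPath

variable {n : ℕ}

theorem length_toList (D : DyckPath n) : D.1.toList.length = 2 * n := by
  rw [← DyckWord.two_mul_semilength_eq_length, D.2]

theorem vertex_spec (D : DyckPath n) {i : ℕ} (hi : i ≤ 2 * n) :
    (D.vertex i).1 + n = (D.vertex i).2 + i ∧ (D.vertex i).1 ≤ n ∧ (D.vertex i).2 ≤ n ∧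
      i ≤ 2 * (D.vertex i).1 := by
  have h1 := count_U_add_count_D (D.1.toList.take i)
  rw [List.length_take, D.length_toList, min_eq_left hi] at h1
  have h2 := D.1.count_D_le_count_U i
  have h3 := (List.take_sublist i D.1.toList).count_le DyckStep.U
  have h4 := (List.take_sublist i D.1.toList).count_le DyckStep.D
  have h5 : D.1.toList.count DyckStep.U = n := D.2
  have h6 := D.1.count_U_eq_count_D
  simp only [vertex]
  omega

theorem vertex_zero (D : DyckPath n) : D.vertex 0 = (0, n) := by
  simp [vertex]

theorem vertex_last (D : DyckPath n) : D.vertex (2 * n) = (n, 0) := by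
  obtain ⟨h1, h2, h3, h4⟩ := D.vertex_spec le_rfl
  exact Prod.ext (by dsimp only; omega) (by dsimp only; omega)

theorem vertex_fst_mono (D : DyckPath n) {i j : ℕ} (h : i ≤ j) :
    (D.vertex i).1 ≤ (D.vertex j).1 :=
  (List.take_sublist_take_left h).count_le _

theorem vertex_snd_anti (D : DyckPath n) {i j : ℕ} (h : i ≤ j) :
    (D.vertex j).2 ≤ (D.vertex i).2 :=
  Nat.sub_le_sub_left ((List.take_sublist_take_left h).count_le _) n

theorem vertex_fst_succ (D : DyckPath n) {i : ℕ} (hi : i < 2 * n) :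
    (D.vertex (i + 1)).1 = (D.vertex i).1 ∨ (D.vertex (i + 1)).1 = (D.vertex i).1 + 1 := by
  have h1 := D.vertex_fst_mono (Nat.le_succ i)
  have h2 := D.vertex_snd_anti (Nat.le_succ i)
  obtain ⟨h3, -⟩ := D.vertex_spec hi.le
  obtain ⟨h4, -⟩ := D.vertex_spec (i := i + 1) hi
  simp only [Nat.succ_eq_add_one] at h1 h2
  omega

theorem height_eq (D : DyckPath n) {i : ℕ} (hi : i ≤ 2 * n) :
    D.height i = 2 * ((D.vertex i).1 : ℤ) - i := by
  obtain ⟨h1, -⟩ := D.vertex_spec hi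
  unfold height heightAt
  omega

/-- A Dyck path is determined by the abscissae of its vertices. -/
theorem ext_vertex_fst {D D' : DyckPath n}
    (h : ∀ i ≤ 2 * n, (D.vertex i).1 = (D'.vertex i).1) : D = D' := by
  refine Subtype.ext (DyckWord.ext (List.ext_getElem ?_ fun i h1 h2 => ?_))
  · rw [D.length_toList, D'.length_toList]
  · have e1 := h i (by rw [D.length_toList] at h1; omega)
    have e2 := h (i + 1) (by rw [D.length_toList] at h1; omega)
    simp only [vertex] at e1 e2
    rw [← List.take_concat_get' _ _ h1, ← List.take_concat_get' _ _ h2, List.count_append,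
      List.count_append, e1, List.count_singleton, List.count_singleton] at e2
    rcases (D.1.toList[i]).dichotomy with h3 | h3 <;>
      rcases (D'.1.toList[i]).dichotomy with h4 | h4 <;> simp_all

/-- The word of steps is read off from the increments of the abscissae. -/
theorem exists_vertex_fst_eq {x : ℕ → ℕ} (h0 : x 0 = 0) (hn : x (2 * n) = n)
    (hs : ∀ i < 2 * n, x (i + 1) = x i ∨ x (i + 1) = x i + 1) (hx : ∀ i ≤ 2 * n, i ≤ 2 * x i) :
    ∃ D : DyckPath n, ∀ i ≤ 2 * n, (D.vertex i).1 = x i := by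
  let l : List DyckStep :=
    (List.range (2 * n)).map fun i => if x (i + 1) = x i then DyckStep.D else DyckStep.U
  have hlen : l.length = 2 * n := by simp [l]
  have hcount : ∀ i ≤ 2 * n, (l.take i).count DyckStep.U = x i := by
    intro i
    induction i with
    | zero => intro _; simp [h0]
    | succ i ih =>
      intro hi
      have e : l[i]'(by omega) = if x (i + 1) = x i then DyckStep.D else DyckStep.U := by
        simp [l]
      rw [← List.take_concat_get' _ _ (by omega : i < l.length), List.count_append, ih (by omega),
        e]
      rcases hs i (by omega) with h | h <;> simp [h]
  have hlast : l.count DyckStep.U = n := by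
    have := hcount (2 * n) le_rfl
    rwa [hn, List.take_of_length_le hlen.le] at this
  have hlast' := count_U_add_count_D l
  refine ⟨⟨⟨l, by omega, fun i => ?_⟩, hlast⟩, fun i hi => hcount i hi⟩
  rcases le_total i (2 * n) with hi | hi
  · have h1 := hcount i hi
    have h2 := count_U_add_count_D (l.take i)
    rw [List.length_take, hlen, min_eq_left hi] at h2
    have := hx i hi
    omega
  · rw [List.take_of_length_le (by omega)]
    omega

end DyckPath

/-! ### Dyck paths as borders of boards -/

theorem IsBorder.unique {n : ℕ} {F : YoungDiagram} {D D' : DyckPath n} (h : IsBorder D F)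
    (h' : IsBorder D' F) : D = D' :=
  DyckPath.ext_vertex_fst fun i hi => by rw [h i hi, h' i hi]

theorem IsDyckBoard.exists_isBorder {n : ℕ} {F : YoungDiagram} (hF : IsDyckBoard n F) :
    ∃ D : DyckPath n, IsBorder D F := by
  obtain ⟨D, hD⟩ := DyckPath.exists_vertex_fst_eq (n := n) (x := fun i => (border n F i).1) rfl
    (by simp [border_last hF.inArray])
    (fun i _ => by rcases border_step n F i with h | h <;> omega) (fun i hi => by
      have h1 := hF.above_diagonal i hi
      have h2 := (border_spec hF.inArray i hi).1
      unfold heightAt at h1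
      omega)
  refine ⟨D, fun i hi => ?_⟩
  have h1 := hD i hi
  have h2 := (border_spec hF.inArray i hi).1
  have h3 := (D.vertex_spec hi).1
  exact Prod.ext h1 (by omega)

theorem DyckPath.exists_board {n : ℕ} (D : DyckPath n) :
    ∃ G : YoungDiagram, IsDyckBoard n G ∧ IsBorder D G := by
  classical
  let G : YoungDiagram :=
    { cells := (Finset.range n ×ˢ Finset.range n).filter fun c =>
        ∃ i ≤ 2 * n, c.1 < (D.vertex i).1 ∧ c.2 < (D.vertex i).2
      isLowerSet := by
        rintro ⟨x, y⟩ ⟨x', y'⟩ hle hc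
        obtain ⟨hx, hy⟩ := Prod.mk_le_mk.1 hle
        simp only [Finset.coe_filter, Finset.mem_product, Finset.mem_range,
          Set.mem_ofPred_eq] at hc ⊢
        obtain ⟨h, i, hi, h1, h2⟩ := hc
        exact ⟨by omega, i, hi, by omega, by omega⟩ }
  have hmem : ∀ x y, (x, y) ∈ G ↔ ∃ i ≤ 2 * n, x < (D.vertex i).1 ∧ y < (D.vertex i).2 := by
    intro x y
    rw [← YoungDiagram.mem_cells]
    simp only [G, Finset.mem_filter, Finset.mem_product, Finset.mem_range, and_iff_right_iff_imp]
    rintro ⟨i, hi, h1, h2⟩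
    obtain ⟨-, h3, h4, -⟩ := D.vertex_spec hi
    omega
  have hG : InArray n G := by
    rintro ⟨x, y⟩ hc
    obtain ⟨i, hi, h1, h2⟩ := (hmem x y).1 hc
    obtain ⟨-, h3, h4, -⟩ := D.vertex_spec hi
    exact ⟨by dsimp only; omega, by dsimp only; omega⟩
  have hb : IsBorder D G := by
    intro i hi
    refine (border_eq_of_onBorder hG hi (D.vertex_spec hi).1 ⟨fun h => ?_, ?_⟩).symm
    · obtain ⟨j, hj, h1, h2⟩ := (hmem _ _).1 h
      rcases le_total i j with hij | hij
      · exact absurd (D.vertex_snd_anti hij) (by omega)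
      · exact absurd (D.vertex_fst_mono hij) (by omega)
    · by_cases h1 : (D.vertex i).1 = 0
      · exact Or.inl h1
      by_cases h2 : (D.vertex i).2 = 0
      · exact Or.inr (Or.inl h2)
      exact Or.inr (Or.inr ((hmem _ _).2 ⟨i, hi, by omega, by omega⟩))
  refine ⟨G, ⟨hG, fun x hx => ?_, fun y hy => ?_, fun i hi => ?_⟩, hb⟩
  · -- The last step of a Dyck path goes south from `(n, 1)`.
    obtain ⟨h1, h2, h3, h4⟩ := D.vertex_spec (i := 2 * n - 1) (by omega)
    exact (hmem _ _).2 ⟨2 * n - 1, by omega, by omega, by omega⟩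
  · -- The first step of a Dyck path goes east from `(0, n)`.
    obtain ⟨h1, h2, h3, h4⟩ := D.vertex_spec (i := 1) (by omega)
    exact (hmem _ _).2 ⟨1, by omega, by omega, by omega⟩
  · rw [← hb i hi]
    obtain ⟨h1, -, -, h4⟩ := D.vertex_spec hi
    unfold heightAt
    omega

/-! ### Placements that avoid 321 and their Dyck paths -/

theorem mem_placementsAvoiding_321_iff {n : ℕ} {F : YoungDiagram} (hF : InArray n F)
    {R : Finset (ℕ × ℕ)} :
    R ∈ placementsAvoiding n F pattern321 ↔ IsFullPlacement F R ∧ IsTripleFree F R := by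
  simp only [placementsAvoiding, Set.mem_ofPred_eq, avoids_iff hF, containsPattern_321_iff]
  exact ⟨fun h => ⟨h.1, h.1.subset, h.1.nonAttacking, h.2⟩, fun h => ⟨h.1, h.2.avoids⟩⟩

/-- By the bounds `h / 2 ≤ ℓ ≤ h`, the numbers `2ℓ - h` along the border are the heights of a Dyck
path that is nowhere above it. -/
theorem exists_dyckPath_of_mem_321 {n : ℕ} {F : YoungDiagram} (hF : IsDyckBoard n F)
    {R : Finset (ℕ × ℕ)} (hR : R ∈ placementsAvoiding n F pattern321) :
    ∃ P ∈ dyckPairs n F, ∀ i ≤ 2 * n, P.1.height i =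
      2 * (longestIncreasing (restrict R (border n F i)) : ℤ) - heightAt n (border n F i) := by
  obtain ⟨h1, h2⟩ := (mem_placementsAvoiding_321_iff hF.inArray).1 hR
  obtain ⟨DF, hDF⟩ := hF.exists_isBorder
  set L : ℕ → ℕ := fun i => longestIncreasing (restrict R (border n F i)) with hL
  have hcard : ∀ i ≤ 2 * n, (restrict R (border n F i)).card + n =
      (border n F i).1 + (border n F i).2 := fun i hi => by
    obtain ⟨-, e2, e3, e4⟩ := border_spec hF.inArray i hi
    exact h1.card_restrict hF.column_iff hF.row_iff e2 e3 e4
  have htwo : ∀ i ≤ 2 * n, L i ≤ (restrict R (border n F i)).card ∧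
      (restrict R (border n F i)).card ≤ 2 * L i := fun i hi =>
    h2.isTwoRow _ _ (onBorder_border hF.inArray hi).2
  -- The abscissa of the `i`-th vertex is `ℓ + n - b`, where `b` is the ordinate of the `i`-th
  -- vertex of the border.
  obtain ⟨D, hD⟩ := DyckPath.exists_vertex_fst_eq (n := n)
    (x := fun i => L i + n - (border n F i).2)
    (by
      have h3 := htwo 0 (Nat.zero_le _)
      have h4 := hcard 0 (Nat.zero_le _)
      have h5 : (border n F 0).1 = 0 ∧ (border n F 0).2 = n := ⟨rfl, rfl⟩
      omega)
    (by
      have h3 := htwo (2 * n) le_rfl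
      have h4 := hcard (2 * n) le_rfl
      have h5 := Prod.ext_iff.1 (border_last hF.inArray)
      dsimp only at h5 ⊢
      omega)
    (by
      intro i hi
      have na : ∀ V, NonAttacking (restrict R V) := fun V =>
        h1.nonAttacking.mono (Finset.filter_subset _ _)
      obtain ⟨e1, e2, e3, -⟩ := border_spec hF.inArray i hi.le
      obtain ⟨e1', e2', e3', -⟩ := border_spec hF.inArray (i + 1) hi
      have c := hcard i hi.le
      have c' := hcard (i + 1) hi
      rcases border_step n F i with ⟨s1, s2⟩ | ⟨s1, s2⟩
      · have g := stats_growsTo_left (R := R) (a := (border n F i).1) (b := (border n F i).2)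
          (na _)
        rw [show ((border n F i).1 + 1, (border n F i).2) = border n F (i + 1) from
          Prod.ext s1.symm s2.symm] at g
        simp only [GrowsTo, stats, Prod.ext_iff, Prod.mk.eta] at g
        simp only [hL]
        omega
      · have g := stats_growsTo_right (R := R) (a := (border n F (i + 1)).1)
          (b := (border n F (i + 1)).2) (na _)
        rw [show ((border n F (i + 1)).1, (border n F (i + 1)).2 + 1) = border n F i from
          Prod.ext s1 s2] at g
        simp only [GrowsTo, stats, Prod.ext_iff, Prod.mk.eta] at g
        have t := htwo i hi.le
        have t' := htwo (i + 1) hi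
        simp only [hL] at t t' ⊢
        omega)
    (by
      intro i hi
      obtain ⟨e1, e2, e3, -⟩ := border_spec hF.inArray i hi
      have h3 := htwo i hi
      have h4 := hcard i hi
      omega)
  have hh : ∀ i ≤ 2 * n, D.height i = 2 * (L i : ℤ) - heightAt n (border n F i) := by
    intro i hi
    obtain ⟨e1, e2, e3, -⟩ := border_spec hF.inArray i hi
    rw [D.height_eq hi, hD i hi]
    unfold heightAt
    omega
  refine ⟨(D, DF), ⟨fun i hi => ?_, hDF⟩, hh⟩
  have e := hcard i hi
  have e' := htwo i hi
  rw [hh i hi, DyckPath.height, hDF i hi]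
  unfold heightAt
  omega

/-- For full placements the number of rooks below a border vertex is fixed, so the lengths of the
longest increasing sequences alone determine a placement that avoids 321. -/
theorem eq_of_longestIncreasing_eq {n : ℕ} {F : YoungDiagram} (hF : IsDyckBoard n F)
    {R R' : Finset (ℕ × ℕ)} (hR : R ∈ placementsAvoiding n F pattern321)
    (hR' : R' ∈ placementsAvoiding n F pattern321)
    (h : ∀ i ≤ 2 * n, longestIncreasing (restrict R (border n F i)) =
      longestIncreasing (restrict R' (border n F i))) : R = R' := by
  obtain ⟨h1, h2⟩ := (mem_placementsAvoiding_321_iff hF.inArray).1 hR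
  obtain ⟨h1', h2'⟩ := (mem_placementsAvoiding_321_iff hF.inArray).1 hR'
  refine h2.eq_of_stats_eq hF.inArray h2' fun a b ha hb hab => ?_
  have e1 := h1.card_restrict hF.column_iff hF.row_iff ha hb hab
  have e2 := h1'.card_restrict hF.column_iff hF.row_iff ha hb hab
  have e3 := h (a + n - b) (by omega)
  rw [border_eq_of_onBorder' hF.inArray ha hb hab] at e3
  exact Prod.ext e3 (by simp only [stats]; omega)

/-- The border statistics that belong to a Dyck path `P.1` below the border are
`ℓ = x + b - n` and `m = a + b - n` at the border vertex `(a, b)`, where `x` is the abscissa of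
the vertex of `P.1` with the same index. -/
theorem exists_placement_321_of_dyckPath {n : ℕ} {F : YoungDiagram} (hF : IsDyckBoard n F)
    {P : DyckPath n × DyckPath n} (hP : P ∈ dyckPairs n F) :
    ∃ R ∈ placementsAvoiding n F pattern321, ∀ i ≤ 2 * n, P.1.height i =
      2 * (longestIncreasing (restrict R (border n F i)) : ℤ) - heightAt n (border n F i) := by
  obtain ⟨D, DF⟩ := P
  obtain ⟨hle, hDF⟩ := hP
  dsimp only at hle hDF ⊢
  -- The vertex of `D` with the same index as the border vertex `(a, b)` has an abscissa of at most
  -- `a` and a nonnegative height.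
  have spec : ∀ a b, a ≤ n → b ≤ n → OnBorder F a b →
      (D.vertex (a + n - b)).1 ≤ a ∧ a + n ≤ 2 * (D.vertex (a + n - b)).1 + b ∧ n ≤ a + b := by
    intro a b ha hb hab
    have hi : a + n - b ≤ 2 * n := by omega
    have h1 := hle _ hi
    have h2 := D.vertex_spec hi
    rw [D.height_eq hi, DF.height_eq hi, hDF _ hi, border_eq_of_onBorder' hF.inArray ha hb hab]
      at h1
    have h3 := hF.above_diagonal _ hi
    rw [border_eq_of_onBorder' hF.inArray ha hb hab] at h3
    unfold heightAt at h3
    omega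
  obtain ⟨R, h1, h2⟩ := exists_isTripleFree hF.inArray
    (B := fun a b => ((D.vertex (a + n - b)).1 + b - n, a + b - n))
    (by
      intro a b ha hb hab
      have := spec a b ha hb hab
      simp only [IsTwoRow]
      omega)
    (by
      intro a b ha hb hab hab'
      have h1 := spec a b ha.le hb hab
      have h2 := spec (a + 1) b ha hb hab'
      have h3 := D.vertex_fst_succ (i := a + n - b) (by omega)
      rw [show a + n - b + 1 = a + 1 + n - b by omega] at h3
      simp only [GrowsTo, Prod.ext_iff]
      omega)
    (by
      intro a b ha hb hab hab'
      have h1 := spec a b ha hb.le hab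
      have h2 := spec a (b + 1) ha hb hab'
      have h3 := D.vertex_fst_succ (i := a + n - (b + 1)) (by omega)
      rw [show a + n - (b + 1) + 1 = a + n - b by omega] at h3
      simp only [GrowsTo, Prod.ext_iff]
      omega)
    (by simp [D.vertex_zero])
    (by simp [← two_mul, D.vertex_last])
  have hfull : IsFullPlacement F R := by
    refine isFullPlacement_of_card_restrict hF.inArray h1.subset h1.nonAttacking
      fun a b ha hb hab => ?_
    have e := congrArg Prod.snd (h2 a b ha hb hab)
    have := spec a b ha hb hab
    simp only [stats] at e
    omega
  refine ⟨R, (mem_placementsAvoiding_321_iff hF.inArray).2 ⟨hfull, h1⟩, fun i hi => ?_⟩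
  obtain ⟨e1, e2, e3, e4⟩ := border_spec hF.inArray i hi
  have e := congrArg Prod.fst (h2 _ _ e2 e3 e4)
  have s := spec _ _ e2 e3 e4
  rw [show (border n F i).1 + n - (border n F i).2 = i by omega] at e s
  simp only [stats, Prod.mk.eta] at e
  rw [e, D.height_eq hi]
  unfold heightAt
  omega

/-! ### Placements that avoid 213 -/

theorem containsPattern_213_iff {S : Finset (ℕ × ℕ)} :
    ContainsPattern S pattern213 ↔
      ∃ p ∈ S, ∃ q ∈ S, ∃ r ∈ S, p.1 < q.1 ∧ q.1 < r.1 ∧ q.2 < p.2 ∧ p.2 < r.2 := by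
  constructor
  · rintro ⟨c, h1, h2, h3⟩
    exact ⟨c 0, h1 0, c 1, h1 1, c 2, h1 2, h2 0 1 (by decide), h2 1 2 (by decide),
      (h3 1 0).2 (by decide), (h3 0 2).2 (by decide)⟩
  · rintro ⟨p, hp, q, hq, r, hr, h1, h2, h3, h4⟩
    refine ⟨![p, q, r], ?_, ?_, ?_⟩
    · intro a
      fin_cases a <;> simpa
    · intro a b
      fin_cases a <;> fin_cases b <;> simp <;> omega
    · intro a b
      fin_cases a <;> fin_cases b <;> simp [pattern213] <;> omega

/-- The last element of an occurrence of 213 is above and to the right of the others, so that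
the shape of the board does not matter. -/
theorem mem_placementsAvoiding_213_iff {n : ℕ} {F : YoungDiagram} (hF : InArray n F)
    {R : Finset (ℕ × ℕ)} :
    R ∈ placementsAvoiding n F pattern213 ↔
      IsFullPlacement F R ∧ ¬ ContainsPattern R pattern213 := by
  simp only [placementsAvoiding, Set.mem_ofPred_eq, avoids_iff hF]
  refine and_congr_right fun hR => ⟨fun h hR' => ?_, fun h x y _ ⟨c, h1, h2⟩ =>
    h ⟨c, fun a => (mem_restrict.1 (h1 a)).1, h2⟩⟩
  obtain ⟨p, hp, q, hq, r, hr, h1, h2, h3, h4⟩ := containsPattern_213_iff.1 hR'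
  exact h r.1 r.2 (hR.mem hr) (containsPattern_213_iff.2
    ⟨p, mem_restrict.2 ⟨hp, by omega, by omega⟩, q, mem_restrict.2 ⟨hq, by omega, by omega⟩,
      r, mem_restrict.2 ⟨hr, by omega, by omega⟩, h1, h2, h3, h4⟩)

theorem mem_minimalBoard {R : Finset (ℕ × ℕ)} {x y : ℕ} :
    (x, y) ∈ minimalBoard R ↔ ∃ r ∈ R, x ≤ r.1 ∧ y ≤ r.2 := by
  rw [← YoungDiagram.mem_cells]
  simp [minimalBoard, Prod.le_def]

theorem IsFullPlacement.minimalBoard_le {F : YoungDiagram} {R : Finset (ℕ × ℕ)}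
    (h : IsFullPlacement F R) : minimalBoard R ≤ F :=
  YoungDiagram.cells_subset_iff.1 ((minimalBoard_isLeast R).2 h.subset)

theorem IsFullPlacement.of_minimalBoard {F : YoungDiagram} {R : Finset (ℕ × ℕ)}
    (h : IsFullPlacement F R) : IsFullPlacement (minimalBoard R) R :=
  ⟨(minimalBoard_isLeast R).1, fun x hx => h.column x (h.minimalBoard_le hx),
    fun y hy => h.row y (h.minimalBoard_le hy)⟩

theorem IsFullPlacement.isDyckBoard_minimalBoard {n : ℕ} {F : YoungDiagram} (hF : IsDyckBoard n F)
    {R : Finset (ℕ × ℕ)} (h : IsFullPlacement F R) : IsDyckBoard n (minimalBoard R) := by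
  refine h.of_minimalBoard.isDyckBoard
    (fun x => ⟨fun hx => (hF.column_iff x).1 (h.minimalBoard_le hx), fun hx => ?_⟩)
    (fun y => ⟨fun hy => (hF.row_iff y).1 (h.minimalBoard_le hy), fun hy => ?_⟩)
  · obtain ⟨y, hy, -⟩ := h.column x ((hF.column_iff x).2 hx)
    exact mem_minimalBoard.2 ⟨_, hy, le_rfl, Nat.zero_le _⟩
  · obtain ⟨x, hx, -⟩ := h.row y ((hF.row_iff y).2 hy)
    exact mem_minimalBoard.2 ⟨_, hx, Nat.zero_le _, le_rfl⟩

/-- Read from right to left, each rook of `R` is in the highest available row: the highest row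
that meets `G` in its column and has no rook further to the right. -/
def IsGreedy (G : YoungDiagram) (R : Finset (ℕ × ℕ)) : Prop :=
  ∀ x y, (x, y) ∈ R → ∀ y', (x, y') ∈ G → (∀ x', x < x' → (x', y') ∉ R) → y' ≤ y

/-- If a higher row is available in some column, then the rook in this row, the rook in this column
and a rook that forces the column of the minimal board to be that high form the pattern 213. -/
theorem IsFullPlacement.isGreedy_minimalBoard {F : YoungDiagram} {R : Finset (ℕ × ℕ)}
    (h : IsFullPlacement F R) (h213 : ¬ ContainsPattern R pattern213) :
    IsGreedy (minimalBoard R) R := by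
  intro x y hxy y' hy' hfree
  by_contra hlt
  obtain ⟨⟨u, v⟩, hr, hu, hv⟩ := mem_minimalBoard.1 hy'
  dsimp only at hu hv
  obtain ⟨x', hx', -⟩ := h.row y'
    (h.minimalBoard_le ((minimalBoard R).up_left_mem (Nat.zero_le _) le_rfl hy'))
  have hne1 : x ≠ u := by
    rintro rfl
    have := congrArg Prod.snd (h.nonAttacking.1 hxy hr rfl)
    dsimp only at this
    omega
  have hne2 : y' ≠ v := by
    rintro rfl
    exact hfree u (by omega) hr
  have hne3 : x' ≠ x := by
    rintro rfl
    have := congrArg Prod.snd (h.nonAttacking.1 hxy hx' rfl)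
    dsimp only at this
    omega
  have hle : ¬ x < x' := fun h => hfree x' h hx'
  exact h213 (containsPattern_213_iff.2
    ⟨_, hx', _, hxy, _, hr, by dsimp only; omega, by dsimp only; omega, by dsimp only; omega,
      by dsimp only; omega⟩)

theorem IsGreedy.eq {n : ℕ} {G : YoungDiagram} (hG : ∀ x, (x, 0) ∈ G ↔ x < n)
    {R R' : Finset (ℕ × ℕ)} (h : IsFullPlacement G R) (h' : IsFullPlacement G R')
    (g : IsGreedy G R) (g' : IsGreedy G R') : R = R' := by
  have key : ∀ k x, n - x = k → ∀ y, (x, y) ∈ R ↔ (x, y) ∈ R' := by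
    intro k
    induction k using Nat.strong_induction_on with
    | _ k ih =>
      intro x hk
      by_cases hx : x < n
      · obtain ⟨y, hy, hu⟩ := h.column x ((hG x).2 hx)
        obtain ⟨y', hy', hu'⟩ := h'.column x ((hG x).2 hx)
        have h1 : y ≤ y' := g' x y' hy' y (h.mem hy) fun x' hlt hmem => by
          have h2 := (ih _ (by omega) x' rfl y).2 hmem
          exact hlt.ne (congrArg Prod.fst (h.nonAttacking.2 hy h2 rfl))
        have h2 : y' ≤ y := g x y hy y' (h'.mem hy') fun x' hlt hmem => by
          have h2 := (ih _ (by omega) x' rfl y').1 hmem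
          exact hlt.ne (congrArg Prod.fst (h'.nonAttacking.2 hy' h2 rfl))
        obtain rfl := le_antisymm h1 h2
        intro z
        exact ⟨fun hz => hu z hz ▸ hy', fun hz => hu' z hz ▸ hy⟩
      · intro y
        have : (x, y) ∉ G := fun hm =>
          hx ((hG x).1 (G.up_left_mem le_rfl (Nat.zero_le _) hm))
        exact ⟨fun hm => absurd (h.mem hm) this, fun hm => absurd (h'.mem hm) this⟩
  ext ⟨x, y⟩
  exact key _ x rfl y

theorem IsGreedy.not_containsPattern_213 {G : YoungDiagram} {R : Finset (ℕ × ℕ)}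
    (h : IsFullPlacement G R) (g : IsGreedy G R) : ¬ ContainsPattern R pattern213 := by
  intro hR
  obtain ⟨p, hp, q, hq, r, hr, h1, h2, h3, h4⟩ := containsPattern_213_iff.1 hR
  have := g q.1 q.2 hq p.2 (G.up_left_mem h2.le h4.le (h.mem hr)) fun x' hlt hmem => by
    have := congrArg Prod.fst (h.nonAttacking.2 hp hmem rfl)
    dsimp only at this
    omega
  omega

theorem IsGreedy.minimalBoard_eq {G : YoungDiagram} {R : Finset (ℕ × ℕ)}
    (h : IsFullPlacement G R) (g : IsGreedy G R) : minimalBoard R = G := by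
  refine le_antisymm h.minimalBoard_le ?_
  rintro ⟨a, b⟩ hab
  -- The rook in the last column that meets row `b` is in row `b` or higher.
  have ha := YoungDiagram.mem_iff_lt_colLen.1 hab
  have hx : (G.colLen b - 1, b) ∈ G := YoungDiagram.mem_iff_lt_colLen.2 (by omega)
  obtain ⟨y, hy, -⟩ := h.column _ (G.up_left_mem le_rfl (Nat.zero_le _) hx)
  refine mem_minimalBoard.2 ⟨_, hy, by dsimp only; omega, g _ y hy b hx fun x' hlt hm => ?_⟩
  have := YoungDiagram.mem_iff_lt_colLen.1 (h.mem hm)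
  omega

theorem IsDyckBoard.le_add_rowLen {n : ℕ} {G : YoungDiagram} (hG : IsDyckBoard n G) {x : ℕ}
    (hx : x ≤ n) : n ≤ x + G.rowLen x := by
  have hb := rowLen_le hG.inArray x
  have h := hG.above_diagonal (x + n - G.rowLen x) (by omega)
  rw [border_eq_of_onBorder' hG.inArray hx hb (onBorder_rowLen G x).1] at h
  unfold heightAt at h
  omega

/-- When the columns are filled from right to left, there is always an available row, since
column `x` has at least `n - x` squares. -/
theorem IsDyckBoard.exists_isGreedy {n : ℕ} {G : YoungDiagram} (hG : IsDyckBoard n G) :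
    ∃ R, IsFullPlacement G R ∧ IsGreedy G R := by
  classical
  have key : ∀ k ≤ n, ∃ R ⊆ G.cells, NonAttacking R ∧ R.image Prod.fst = Finset.Ico (n - k) n ∧
      IsGreedy G R := by
    intro k
    induction k with
    | zero =>
      intro _
      exact ⟨∅, by simp, by simp [NonAttacking], by simp, by simp [IsGreedy]⟩
    | succ k ih =>
      intro hk
      obtain ⟨R, h1, h2, h3, h4⟩ := ih (by omega)
      obtain ⟨x, hx⟩ : ∃ x, x + k + 1 = n := ⟨n - k - 1, by omega⟩
      have hcard : R.card = k := by
        rw [← Finset.card_image_of_injOn h2.1, h3, Nat.card_Ico]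
        omega
      have hcol : ∀ c ∈ R, x < c.1 := fun c hc => by
        have : c.1 ∈ Finset.Ico (n - k) n := h3 ▸ Finset.mem_image_of_mem _ hc
        rw [Finset.mem_Ico] at this
        omega
      have hne : (Finset.range (G.rowLen x) \ R.image Prod.snd).Nonempty := by
        rw [← Finset.card_pos]
        have e1 := Finset.le_card_sdiff (R.image Prod.snd) (Finset.range (G.rowLen x))
        have e2 := Finset.card_image_le (s := R) (f := Prod.snd)
        have e3 := hG.le_add_rowLen (x := x) (by omega)
        rw [Finset.card_range] at e1
        omega
      obtain ⟨y, hy, hmax⟩ : ∃ y ∈ Finset.range (G.rowLen x) \ R.image Prod.snd,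
          ∀ y' ∈ Finset.range (G.rowLen x) \ R.image Prod.snd, y' ≤ y :=
        ⟨_, Finset.max'_mem _ hne, fun y' h => Finset.le_max' _ y' h⟩
      rw [Finset.mem_sdiff, Finset.mem_range, Finset.mem_image] at hy
      have hnew : (x, y) ∉ R := fun h => lt_irrefl _ (hcol _ h)
      refine ⟨insert (x, y) R, ?_, ⟨?_, ?_⟩, ?_, ?_⟩
      · exact Finset.insert_subset ((YoungDiagram.mem_cells _).2
          (YoungDiagram.mem_iff_lt_rowLen.2 hy.1)) h1
      · rw [Finset.coe_insert, Set.injOn_insert hnew]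
        refine ⟨h2.1, ?_⟩
        rintro ⟨c, hc, rfl⟩
        exact lt_irrefl _ (hcol c hc)
      · rw [Finset.coe_insert, Set.injOn_insert hnew]
        refine ⟨h2.2, ?_⟩
        rintro ⟨c, hc, hcy⟩
        exact hy.2 ⟨c, hc, hcy⟩
      · rw [Finset.image_insert, h3]
        ext z
        simp only [Finset.mem_insert, Finset.mem_Ico]
        omega
      · intro x0 y0 h0 y' hy' hfree
        rcases Finset.mem_insert.1 h0 with h0 | h0
        · obtain ⟨rfl, rfl⟩ := Prod.mk.inj h0
          refine hmax y' (Finset.mem_sdiff.2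
            ⟨Finset.mem_range.2 (YoungDiagram.mem_iff_lt_rowLen.1 hy'), fun hm => ?_⟩)
          obtain ⟨⟨x', y''⟩, hc, rfl⟩ := Finset.mem_image.1 hm
          exact hfree x' (hcol _ hc) (Finset.mem_insert_of_mem hc)
        · exact h4 x0 y0 h0 y' hy' fun x' hlt hm => hfree x' hlt (Finset.mem_insert_of_mem hm)
  obtain ⟨R, h1, h2, h3, h4⟩ := key n le_rfl
  rw [Nat.sub_self] at h3
  have hrows : R.image Prod.snd = Finset.range n := by
    refine Finset.eq_of_subset_of_card_le (fun y hy => ?_) ?_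
    · obtain ⟨c, hc, rfl⟩ := Finset.mem_image.1 hy
      exact Finset.mem_range.2 (hG.inArray _ ((YoungDiagram.mem_cells _).1 (h1 hc))).2
    · rw [Finset.card_image_of_injOn h2.2, ← Finset.card_image_of_injOn h2.1, h3, Nat.card_Ico,
        Finset.card_range, Nat.sub_zero]
  refine ⟨R, ⟨h1, fun x hx => ?_, fun y hy => ?_⟩, h4⟩
  · have : x ∈ R.image Prod.fst := by
      rw [h3]
      exact Finset.mem_Ico.2 ⟨Nat.zero_le _, (hG.column_iff x).1 hx⟩
    obtain ⟨⟨x', y⟩, hc, rfl⟩ := Finset.mem_image.1 this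
    exact ⟨y, hc, fun y' hy' => congrArg Prod.snd (h2.1 hy' hc rfl)⟩
  · have : y ∈ R.image Prod.snd := by
      rw [hrows]
      exact Finset.mem_range.2 ((hG.row_iff y).1 hy)
    obtain ⟨⟨x, y'⟩, hc, rfl⟩ := Finset.mem_image.1 this
    exact ⟨x, hc, fun x' hx' => congrArg Prod.fst (h2.2 hx' hc rfl)⟩

theorem exists_dyckPath_of_mem_213 {n : ℕ} {F : YoungDiagram} (hF : IsDyckBoard n F)
    {R : Finset (ℕ × ℕ)} (hR : R ∈ placementsAvoiding n F pattern213) :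
    ∃ P ∈ dyckPairs n F, IsBorder P.1 (minimalBoard R) := by
  obtain ⟨h, -⟩ := (mem_placementsAvoiding_213_iff hF.inArray).1 hR
  obtain ⟨DF, hDF⟩ := hF.exists_isBorder
  obtain ⟨D, hD⟩ := (h.isDyckBoard_minimalBoard hF).exists_isBorder
  refine ⟨(D, DF), ⟨fun i hi => ?_, hDF⟩, hD⟩
  have := border_fst_le_of_le hF.inArray h.minimalBoard_le hi
  dsimp only
  rw [D.height_eq hi, DF.height_eq hi, hD i hi, hDF i hi]
  omega

theorem eq_of_minimalBoard_eq {n : ℕ} {F : YoungDiagram} (hF : IsDyckBoard n F)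
    {R R' : Finset (ℕ × ℕ)} (hR : R ∈ placementsAvoiding n F pattern213)
    (hR' : R' ∈ placementsAvoiding n F pattern213) (e : minimalBoard R = minimalBoard R') :
    R = R' := by
  obtain ⟨h1, h2⟩ := (mem_placementsAvoiding_213_iff hF.inArray).1 hR
  obtain ⟨h1', h2'⟩ := (mem_placementsAvoiding_213_iff hF.inArray).1 hR'
  refine IsGreedy.eq (h1.isDyckBoard_minimalBoard hF).column_iff h1.of_minimalBoard ?_
    (h1.isGreedy_minimalBoard h2) ?_
  · rw [e]
    exact h1'.of_minimalBoard
  · rw [e]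
    exact h1'.isGreedy_minimalBoard h2'

theorem exists_placement_213_of_dyckPath {n : ℕ} {F : YoungDiagram} (hF : IsDyckBoard n F)
    {P : DyckPath n × DyckPath n} (hP : P ∈ dyckPairs n F) :
    ∃ R ∈ placementsAvoiding n F pattern213, IsBorder P.1 (minimalBoard R) := by
  obtain ⟨D, DF⟩ := P
  obtain ⟨hle, hDF⟩ := hP
  dsimp only at hle hDF ⊢
  obtain ⟨G, hG, hD⟩ := D.exists_board
  obtain ⟨R, h, g⟩ := hG.exists_isGreedy
  have hGF : G ≤ F := le_of_border_fst_le hF.inArray hG.inArray fun i hi => by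
    have := hle i hi
    rw [D.height_eq hi, DF.height_eq hi, hD i hi, hDF i hi] at this
    omega
  have hR : IsFullPlacement F R :=
    ⟨h.subset.trans (YoungDiagram.cells_subset_iff.2 hGF),
      fun x hx => h.column x ((hG.column_iff x).2 ((hF.column_iff x).1 hx)),
      fun y hy => h.row y ((hG.row_iff y).2 ((hF.row_iff y).1 hy))⟩
  refine ⟨R, (mem_placementsAvoiding_213_iff hF.inArray).2 ⟨hR, g.not_containsPattern_213 h⟩, ?_⟩
  rw [g.minimalBoard_eq h]
  exact hD

/-! ### Matchings -/

theorem border_fst_mono (n : ℕ) (F : YoungDiagram) : Monotone fun i => (border n F i).1 :=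
  monotone_nat_of_le_succ fun i => by rcases border_step n F i with h | h <;> omega

theorem border_snd_anti (n : ℕ) (F : YoungDiagram) : Antitone fun i => (border n F i).2 :=
  antitone_nat_of_succ_le fun i => by rcases border_step n F i with h | h <;> omega

/-- The `i`-th step of the border goes east. -/
def IsEastStep (n : ℕ) (F : YoungDiagram) (i : ℕ) : Prop :=
  (border n F (i + 1)).1 = (border n F i).1 + 1

theorem not_isEastStep_iff {n : ℕ} {F : YoungDiagram} {i : ℕ} :
    ¬ IsEastStep n F i ↔ (border n F (i + 1)).1 = (border n F i).1 ∧
      (border n F (i + 1)).2 + 1 = (border n F i).2 := by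
  unfold IsEastStep
  rcases border_step n F i with h | h <;> omega

theorem IsEastStep.eq {n : ℕ} {F : YoungDiagram} {i j : ℕ} (hi : IsEastStep n F i)
    (hj : IsEastStep n F j) (h : (border n F i).1 = (border n F j).1) : i = j := by
  unfold IsEastStep at hi hj
  rcases lt_trichotomy i j with hij | hij | hij
  · have := border_fst_mono n F (Nat.succ_le_of_lt hij)
    simp only [Nat.succ_eq_add_one] at this
    omega
  · exact hij
  · have := border_fst_mono n F (Nat.succ_le_of_lt hij)
    simp only [Nat.succ_eq_add_one] at this
    omega

theorem southStep_eq {n : ℕ} {F : YoungDiagram} {i j : ℕ} (hi : ¬ IsEastStep n F i)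
    (hj : ¬ IsEastStep n F j) (h : (border n F (i + 1)).2 = (border n F (j + 1)).2) : i = j := by
  rw [not_isEastStep_iff] at hi hj
  rcases lt_trichotomy i j with hij | hij | hij
  · have := border_snd_anti n F (Nat.succ_le_of_lt hij)
    simp only [Nat.succ_eq_add_one] at this
    omega
  · exact hij
  · have := border_snd_anti n F (Nat.succ_le_of_lt hij)
    simp only [Nat.succ_eq_add_one] at this
    omega

theorem exists_eastStep {n : ℕ} {F : YoungDiagram} (hF : InArray n F) {x : ℕ} (hx : x < n) :
    ∃ i < 2 * n, IsEastStep n F i ∧ (border n F i).1 = x := by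
  have hb := rowLen_le hF x
  obtain ⟨h1, h2⟩ := onBorder_rowLen F x
  have e1 := border_eq_of_onBorder (i := x + n - F.rowLen x) hF (by omega) (by omega) h1
  have e2 := border_eq_of_onBorder (i := x + n - F.rowLen x + 1) hF (by omega) (by omega) h2
  exact ⟨x + n - F.rowLen x, by omega, by rw [IsEastStep, e1, e2], by rw [e1]⟩

theorem exists_southStep {n : ℕ} {F : YoungDiagram} (hF : InArray n F) {y : ℕ} (hy : y < n) :
    ∃ j < 2 * n, ¬ IsEastStep n F j ∧ (border n F (j + 1)).2 = y := by
  have ha := colLen_le hF y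
  obtain ⟨h1, h2⟩ := onBorder_colLen F y
  have e1 := border_eq_of_onBorder (i := F.colLen y + n - (y + 1) + 1) hF (by omega) (by omega) h1
  have e2 := border_eq_of_onBorder (i := F.colLen y + n - (y + 1)) hF (by omega) (by omega) h2
  exact ⟨F.colLen y + n - (y + 1), by omega, by rw [IsEastStep, e1, e2]; simp, by rw [e1]⟩

theorem card_filter_lt_succ {N : ℕ} (S : Finset (Fin N)) {i : ℕ} (hi : i < N) :
    (S.filter fun v => v.val < i + 1).card =
      (S.filter fun v => v.val < i).card + if (⟨i, hi⟩ : Fin N) ∈ S then 1 else 0 := by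
  split_ifs with h
  · rw [← Finset.card_insert_of_notMem (a := (⟨i, hi⟩ : Fin N)) (by simp)]
    congr 1
    ext v
    simp only [Finset.mem_filter, Finset.mem_insert, Fin.ext_iff]
    constructor
    · rintro ⟨h1, h2⟩
      by_cases hv : v.val = i
      · exact Or.inl hv
      · exact Or.inr ⟨h1, by omega⟩
    · rintro (h1 | ⟨h1, h2⟩)
      · exact ⟨by rwa [show v = ⟨i, hi⟩ from Fin.ext h1], by omega⟩
      · exact ⟨h1, by omega⟩
  · rw [add_zero]
    congr 1
    ext v
    simp only [Finset.mem_filter]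
    refine and_congr_right fun h1 => ?_
    have : v.val ≠ i := fun hv => h (by rwa [← show v = ⟨i, hi⟩ from Fin.ext hv])
    omega

namespace PerfectMatching

variable {n : ℕ}

theorem mem_openers {M : PerfectMatching n} {v : Fin (2 * n)} :
    v ∈ M.openers ↔ ∃ p ∈ M.pairs, p.1 = v := by
  simp [openers]

theorem mem_closers {M : PerfectMatching n} {v : Fin (2 * n)} :
    v ∈ M.closers ↔ ∃ p ∈ M.pairs, p.2 = v := by
  simp [closers]

theorem mem_closers_iff (M : PerfectMatching n) (v : Fin (2 * n)) :
    v ∈ M.closers ↔ v ∉ M.openers := by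
  rw [mem_closers, mem_openers]
  constructor
  · rintro ⟨p, hp, hpv⟩ ⟨q, hq, hqv⟩
    have := (M.covers v).unique ⟨hp, Or.inr hpv⟩ ⟨hq, Or.inl hqv⟩
    subst this
    exact (M.fst_lt_snd p hp).ne (hqv.trans hpv.symm)
  · intro h
    obtain ⟨p, ⟨hp, hpv⟩, -⟩ := M.covers v
    exact ⟨p, hp, hpv.resolve_left fun h' => h ⟨p, hp, h'⟩⟩

variable {F : YoungDiagram} {M : PerfectMatching n}

theorem HasShape.mem_openers_iff (hM : M.HasShape F) (v : Fin (2 * n)) :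
    v ∈ M.openers ↔ IsEastStep n F v := by
  have h1 := congrArg Prod.fst (hM v v.2.le)
  have h2 := congrArg Prod.fst (hM (v + 1) v.2)
  simp only [pathVertex] at h1 h2
  rw [card_filter_lt_succ _ v.2, h1, Fin.eta] at h2
  rw [IsEastStep, ← h2]
  split_ifs with h <;> simp [h]

theorem HasShape.column_eq (hM : M.HasShape F) (v : Fin (2 * n)) :
    M.column v = (border n F v).1 :=
  congrArg Prod.fst (hM v v.2.le)

theorem HasShape.card_closers (hF : InArray n F) (hM : M.HasShape F) : M.closers.card = n := by
  have h1 := congrArg Prod.fst (hM (2 * n) le_rfl)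
  rw [border_last hF] at h1
  simp only [pathVertex] at h1
  rw [Finset.filter_true_of_mem fun v _ => v.2] at h1
  have h2 : M.closers = M.openersᶜ := by
    ext v
    rw [Finset.mem_compl, M.mem_closers_iff]
  rw [h2, Finset.card_compl, h1, Fintype.card_fin]
  omega

theorem HasShape.row_eq (hF : InArray n F) (hM : M.HasShape F) (v : Fin (2 * n)) :
    M.row v = (border n F (v + 1)).2 := by
  have h1 := congrArg Prod.snd (hM (v + 1) v.2)
  have h2 := hM.card_closers hF
  have h3 := Finset.card_filter_add_card_filter_not (s := M.closers)
    (fun w : Fin (2 * n) => w.val < v.val + 1)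
  have h4 : (M.closers.filter fun w : Fin (2 * n) => ¬ w.val < v.val + 1) =
      M.closers.filter fun w => v < w := by
    ext w
    simp only [Finset.mem_filter, Fin.lt_def]
    refine and_congr_right fun _ => ?_
    omega
  rw [h4] at h3
  simp only [pathVertex] at h1
  unfold row
  omega

/-- A pair of a matching is recovered from the column and the row of its rook, since the opener
is the east step in this column and the closer is the south step in this row. -/
theorem HasShape.mem_pairs_iff (hF : InArray n F) (hM : M.HasShape F)
    (p : Fin (2 * n) × Fin (2 * n)) :
    p ∈ M.pairs ↔ IsEastStep n F p.1 ∧ ¬ IsEastStep n F p.2 ∧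
      ((border n F p.1).1, (border n F (p.2 + 1)).2) ∈ M.rooks := by
  have hE : ∀ q ∈ M.pairs, IsEastStep n F q.1 ∧ ¬ IsEastStep n F q.2 := fun q hq =>
    ⟨(hM.mem_openers_iff _).1 (mem_openers.2 ⟨q, hq, rfl⟩), fun h =>
      (M.mem_closers_iff _).1 (mem_closers.2 ⟨q, hq, rfl⟩) ((hM.mem_openers_iff _).2 h)⟩
  simp only [rooks, Finset.mem_image, hM.column_eq, hM.row_eq hF, Prod.mk.injEq]
  constructor
  · intro hp
    exact ⟨(hE p hp).1, (hE p hp).2, p, hp, rfl, rfl⟩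
  · rintro ⟨h1, h2, q, hq, h3, h4⟩
    have e1 := (hE q hq).1.eq h1 h3
    have e2 := southStep_eq (hE q hq).2 h2 h4
    rwa [← show q = p from Prod.ext (Fin.ext e1) (Fin.ext e2)]

theorem HasShape.eq_of_rooks_eq (hF : InArray n F) (hM : M.HasShape F) {M' : PerfectMatching n}
    (hM' : M'.HasShape F) (h : M.rooks = M'.rooks) : M = M' := by
  have e : M.pairs = M'.pairs := by
    ext p
    rw [hM.mem_pairs_iff hF, hM'.mem_pairs_iff hF, h]
  cases M
  cases M'
  congr

end PerfectMatching

/-- The matching consists of the pairs of an east step and a south step of the border such that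
there is a rook in the column of the former and the row of the latter. -/
theorem IsFullPlacement.exists_perfectMatching {n : ℕ} {F : YoungDiagram} (hF : IsDyckBoard n F)
    {R : Finset (ℕ × ℕ)} (hR : IsFullPlacement F R) :
    ∃ M : PerfectMatching n, M.HasShape F ∧ M.rooks = R := by
  classical
  set P : Finset (Fin (2 * n) × Fin (2 * n)) := Finset.univ.filter fun p =>
    IsEastStep n F p.1 ∧ ¬ IsEastStep n F p.2 ∧
      ((border n F p.1).1, (border n F (p.2 + 1)).2) ∈ R with hP
  have memP : ∀ p, p ∈ P ↔ IsEastStep n F p.1 ∧ ¬ IsEastStep n F p.2 ∧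
      ((border n F p.1).1, (border n F (p.2 + 1)).2) ∈ R := by simp [hP]
  have exP : ∀ x y, (x, y) ∈ R → ∃ p ∈ P, (border n F p.1).1 = x ∧
      (border n F (p.2 + 1)).2 = y := by
    intro x y hxy
    obtain ⟨hx, hy⟩ := hF.inArray _ (hR.mem hxy)
    obtain ⟨i, hi, hiE, rfl⟩ := exists_eastStep hF.inArray hx
    obtain ⟨j, hj, hjS, rfl⟩ := exists_southStep hF.inArray hy
    exact ⟨(⟨i, hi⟩, ⟨j, hj⟩), (memP _).2 ⟨hiE, hjS, hxy⟩, rfl, rfl⟩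
  -- A square to the right of a south step and below a later east step is not in the board.
  have hlt : ∀ p ∈ P, p.1 < p.2 := by
    intro p hp
    obtain ⟨h1, h2, h3⟩ := (memP p).1 hp
    rw [Fin.lt_def]
    by_contra hge
    have hne : p.1.val ≠ p.2.val := fun h => h2 (h ▸ h1)
    have h4 := border_snd_anti n F (show p.2.val + 1 ≤ p.1.val by omega)
    exact (onBorder_border hF.inArray p.1.2.le).1 (F.up_left_mem le_rfl h4 (hR.mem h3))
  have hcov : ∀ v, ∃! p, p ∈ P ∧ (p.1 = v ∨ p.2 = v) := by
    intro v
    by_cases hv : IsEastStep n F v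
    · have hx : (border n F v).1 < n := by
        have h2 := (border_spec hF.inArray (v + 1) v.2).2.1
        unfold IsEastStep at hv
        omega
      obtain ⟨y, hy, -⟩ := hR.column _ ((hF.column_iff _).2 hx)
      obtain ⟨p, hp, e1, e2⟩ := exP _ _ hy
      have hpE := (memP p).1 hp
      refine ⟨p, ⟨hp, Or.inl (Fin.ext (hpE.1.eq hv e1))⟩, ?_⟩
      rintro q ⟨hq, hqv⟩
      have hqE := (memP q).1 hq
      have e3 : q.1 = v := hqv.resolve_right fun h => hqE.2.1 (h ▸ hv)
      have e4 : (border n F (q.2 + 1)).2 = (border n F (p.2 + 1)).2 := by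
        rw [e2]
        exact congrArg Prod.snd (hR.nonAttacking.1 hqE.2.2 hy (by dsimp only; rw [e3]))
      exact Prod.ext (Fin.ext (by rw [e3]; exact (hpE.1.eq hv e1).symm))
        (Fin.ext (southStep_eq hqE.2.1 hpE.2.1 e4))
    · have hy : (border n F (v + 1)).2 < n := by
        have h2 := (border_spec hF.inArray v v.2.le).2.2.1
        have h3 := not_isEastStep_iff.1 hv
        omega
      obtain ⟨x, hx, -⟩ := hR.row _ ((hF.row_iff _).2 hy)
      obtain ⟨p, hp, e1, e2⟩ := exP _ _ hx
      have hpE := (memP p).1 hp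
      refine ⟨p, ⟨hp, Or.inr (Fin.ext (southStep_eq hpE.2.1 hv e2))⟩, ?_⟩
      rintro q ⟨hq, hqv⟩
      have hqE := (memP q).1 hq
      have e3 : q.2 = v := hqv.resolve_left fun h => hv (h ▸ hqE.1)
      have e4 : (border n F q.1).1 = (border n F p.1).1 := by
        rw [e1]
        exact congrArg Prod.fst (hR.nonAttacking.2 hqE.2.2 hx (by dsimp only; rw [e3]))
      exact Prod.ext (Fin.ext (hqE.1.eq hpE.1 e4))
        (Fin.ext (by rw [e3]; exact (southStep_eq hpE.2.1 hv e2).symm))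
  let M : PerfectMatching n := ⟨P, hlt, hcov⟩
  have hop : ∀ v, v ∈ M.openers ↔ IsEastStep n F v := by
    intro v
    rw [PerfectMatching.mem_openers]
    constructor
    · rintro ⟨p, hp, rfl⟩
      exact ((memP p).1 hp).1
    · intro hv
      obtain ⟨p, ⟨hp, hpv⟩, -⟩ := hcov v
      exact ⟨p, hp, hpv.resolve_right fun h => ((memP p).1 hp).2.1 (h ▸ hv)⟩
  have hM : M.HasShape F := by
    have key : ∀ i ≤ 2 * n, (M.openers.filter fun v => v.val < i).card = (border n F i).1 ∧
        (M.closers.filter fun v => v.val < i).card + (border n F i).2 = n := by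
      intro i
      induction i with
      | zero => intro _; simp [border]
      | succ i ih =>
        intro hi
        obtain ⟨h1, h2⟩ := ih (by omega)
        have hi' : i < 2 * n := hi
        rw [card_filter_lt_succ _ hi', card_filter_lt_succ _ hi', h1]
        simp only [M.mem_closers_iff, hop]
        by_cases hE : IsEastStep n F i
        · have h3 : (border n F (i + 1)).1 = (border n F i).1 + 1 := hE
          have h4 := border_step n F i
          simp only [hE, if_true, not_true_eq_false, if_false]
          omega
        · have h3 := not_isEastStep_iff.1 hE
          simp only [hE, if_false, not_false_eq_true, if_true]
          omega
    intro i hi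
    obtain ⟨h1, h2⟩ := key i hi
    exact Prod.ext h1 (by simp only [PerfectMatching.pathVertex]; omega)
  refine ⟨M, hM, ?_⟩
  ext ⟨x, y⟩
  simp only [PerfectMatching.rooks, Finset.mem_image, hM.column_eq, hM.row_eq hF.inArray]
  constructor
  · rintro ⟨p, hp, e⟩
    rw [← e]
    exact ((memP p).1 hp).2.2
  · intro hxy
    obtain ⟨p, hp, rfl, rfl⟩ := exP x y hxy
    exact ⟨p, hp, rfl⟩

theorem kappa_bijective {k n : ℕ} {F : YoungDiagram} (hF : IsDyckBoard n F)
    (τ : Equiv.Perm (Fin k)) : Function.Bijective (kappa n F τ) := by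
  constructor
  · rintro ⟨M, hM⟩ ⟨M', hM'⟩ h
    exact Subtype.ext (hM.1.eq_of_rooks_eq hF.inArray hM'.1 (congrArg Subtype.val h))
  · rintro ⟨R, hR⟩
    obtain ⟨M, hM, rfl⟩ := hR.1.exists_perfectMatching hF
    exact ⟨⟨M, hM, hR⟩, rfl⟩

/-! ### The bijections -/

theorem exists_bijective_321 {n : ℕ} {F : YoungDiagram} (hF : IsDyckBoard n F) :
    ∃ δ : placementsAvoiding n F pattern321 → dyckPairs n F,
      (∀ R : placementsAvoiding n F pattern321, ∀ i ≤ 2 * n, (δ R).1.1.height i =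
        2 * (longestIncreasing (restrict R.1 (border n F i)) : ℤ) - heightAt n (border n F i)) ∧
      Function.Bijective δ := by
  choose δ h1 h2 using fun R : placementsAvoiding n F pattern321 =>
    exists_dyckPath_of_mem_321 hF R.2
  refine ⟨fun R => ⟨δ R, h1 R⟩, h2, fun R R' h => ?_, fun ⟨P, hP⟩ => ?_⟩
  · have e : δ R = δ R' := congrArg Subtype.val h
    refine Subtype.ext (eq_of_longestIncreasing_eq hF R.2 R'.2 fun i hi => ?_)
    have h3 := h2 R i hi
    rw [e, h2 R' i hi] at h3
    omega
  · obtain ⟨R, hR, hRP⟩ := exists_placement_321_of_dyckPath hF hP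
    refine ⟨⟨R, hR⟩, Subtype.ext (Prod.ext ?_ ((h1 ⟨R, hR⟩).2.unique hP.2))⟩
    refine DyckPath.ext_vertex_fst fun i hi => ?_
    have h3 := (h2 ⟨R, hR⟩ i hi).trans (hRP i hi).symm
    rw [DyckPath.height_eq _ hi, DyckPath.height_eq _ hi] at h3
    dsimp only
    omega

theorem exists_bijective_213 {n : ℕ} {F : YoungDiagram} (hF : IsDyckBoard n F) :
    ∃ δ : placementsAvoiding n F pattern213 → dyckPairs n F,
      (∀ R : placementsAvoiding n F pattern213, IsBorder (δ R).1.1 (minimalBoard R.1)) ∧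
      Function.Bijective δ := by
  choose δ h1 h2 using fun R : placementsAvoiding n F pattern213 =>
    exists_dyckPath_of_mem_213 hF R.2
  refine ⟨fun R => ⟨δ R, h1 R⟩, h2, fun R R' h => ?_, fun ⟨P, hP⟩ => ?_⟩
  · have e : δ R = δ R' := congrArg Subtype.val h
    refine Subtype.ext (eq_of_minimalBoard_eq hF R.2 R'.2
      (eq_of_border_eq (n := n) ?_ ?_ fun i hi => ?_))
    · exact (R.2.1.isDyckBoard_minimalBoard hF).inArray
    · exact (R'.2.1.isDyckBoard_minimalBoard hF).inArray
    · rw [← h2 R i hi, ← h2 R' i hi, e]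
  · obtain ⟨R, hR, hRP⟩ := exists_placement_213_of_dyckPath hF hP
    exact ⟨⟨R, hR⟩, Subtype.ext (Prod.ext ((h2 ⟨R, hR⟩).unique hRP) ((h1 ⟨R, hR⟩).2.unique hP.2))⟩

theorem placementsAvoiding_congr {k m n : ℕ} {F : YoungDiagram} (hm : InArray m F)
    (hn : InArray n F) (τ : Equiv.Perm (Fin (k + 1))) :
    placementsAvoiding m F τ = placementsAvoiding n F τ := by
  ext R
  simp only [placementsAvoiding, Set.mem_ofPred_eq, avoids_iff hm, avoids_iff hn]

/-- A board with a full placement is a Dyck board for the number of its columns; the other boards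
have no full placement at all. -/
theorem shapeWilfEquivalent_321_213 : ShapeWilfEquivalent pattern321 pattern213 := by
  intro n F hF
  by_cases hex : ∃ R, IsFullPlacement F R
  · obtain ⟨R, hR⟩ := hex
    have hD : IsDyckBoard (F.colLen 0) F := hR.isDyckBoard
      (fun x => YoungDiagram.mem_iff_lt_colLen)
      (fun y => hR.rowLen_eq_colLen ▸ YoungDiagram.mem_iff_lt_rowLen)
    rw [placementsAvoiding_congr hF hD.inArray, placementsAvoiding_congr hF hD.inArray]
    obtain ⟨δ, -, hδ⟩ := exists_bijective_321 hD
    obtain ⟨ε, -, hε⟩ := exists_bijective_213 hD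
    exact (Nat.card_eq_of_bijective δ hδ).trans (Nat.card_eq_of_bijective ε hε).symm
  · have empty : ∀ τ : Equiv.Perm (Fin 3), placementsAvoiding n F τ = ∅ := fun τ =>
      Set.eq_empty_of_forall_notMem fun R hR => hex ⟨R, hR.1⟩
    rw [empty, empty]

end FerrersMatching

theorem mainTheorem2 :
    (∀ (n : ℕ) (F : YoungDiagram), IsDyckBoard n F →
      (∃ δ : placementsAvoiding n F pattern321 → dyckPairs n F,
        (∀ R : placementsAvoiding n F pattern321, ∀ i ≤ 2 * n,
          (δ R).1.1.height i =
            2 * (longestIncreasing (restrict R.1 (border n F i)) : ℤ)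
              - heightAt n (border n F i)) ∧
        Function.Bijective δ ∧
        Function.Bijective (δ ∘ kappa n F pattern321)) ∧
      (∃ δ : placementsAvoiding n F pattern213 → dyckPairs n F,
        (∀ R : placementsAvoiding n F pattern213,
          IsBorder (δ R).1.1 (minimalBoard R.1)) ∧
        Function.Bijective δ ∧
        Function.Bijective (δ ∘ kappa n F pattern213))) ∧
    ShapeWilfEquivalent pattern321 pattern213 := by
  refine ⟨fun n F hF => ⟨?_, ?_⟩, shapeWilfEquivalent_321_213⟩
  · obtain ⟨δ, h, hδ⟩ := exists_bijective_321 hF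
    exact ⟨δ, h, hδ, hδ.comp (kappa_bijective hF _)⟩
  · obtain ⟨δ, h, hδ⟩ := exists_bijective_213 hF
    exact ⟨δ, h, hδ, hδ.comp (kappa_bijective hF _)⟩
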